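/- Let $f:\mathbb{R}^d\to\mathbb{R}$ be continuously differentiable and suppose that $f$ attains its minimum. All norms are Euclidean, and $\log$ is the natural logarithm. (a) Suppose that $f$ is quasiconvex, that is, all its sublevel sets are convex (for differentiable $f$, equivalently: $f(y)\le f(x)$ implies $\langle\nabla f(x),y-x\rangle\le 0$). Then every gradient flow curve $(x_t)_{t\ge 0}$ of $f$, i.e. every solution of $\dot x_t=-\nabla f(x_t)$ on $[0,\infty)$, converges to a point $x_\infty$, and its path length satisfies $$\int_0^\infty\|\dot x_t\|\,dt\;\le\;2^{2d\log d}\,\|x_0-x_\infty\|.$$ (b) Suppose that $f$ is convex with $L$-Lipschitz gradient for some $L>0$, and let $x_{k+1}=x_k-\eta\nabla f(x_k)$, $k=0,1,2,\dots$, be gradient descent iterates with step size $\eta>0$ and an arbitrary initial point $x_0$. If $\eta\le 1/L$, then $x_k$ converges to a point $x_\infty$ and $$\sum_{k=0}^\infty\|x_k-x_{k+1}\|\;\le\;2^{10d^2}\,\|x_0-x_\infty\|;$$ if $\eta\le \dfrac{1}{2L\sqrt d}$, then $x_k$ converges to a point $x_\infty$ and $$\sum_{k=0}^\infty\|x_k-x_{k+1}\|\;\le\;2^{4d\log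 d}\,\|x_0-x_\infty\|.$$ -/

import Mathlib

open Set Filter Topology MeasureTheory
open scoped ENNReal NNReal

/-- `x` is a gradient flow curve of `f`: it solves `x'(t) = -∇f(x(t))` for all `t ≥ 0`
(one-sided derivative at `t = 0`). The values of `x` at negative times play no role. -/
def IsGradientFlow {d : ℕ} (f : EuclideanSpace ℝ (Fin d) → ℝ)
    (x : ℝ → EuclideanSpace ℝ (Fin d)) : Prop :=
  ∀ t : ℝ, 0 ≤ t → HasDerivWithinAt x (-gradient f (x t)) (Ici 0) t

/-- `x` is the sequence of gradient descent iterates of `f` with step size `η`, started at `x 0`. -/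
def IsGradientDescent {d : ℕ} (f : EuclideanSpace ℝ (Fin d) → ℝ) (η : ℝ)
    (x : ℕ → EuclideanSpace ℝ (Fin d)) : Prop :=
  ∀ k : ℕ, x (k + 1) = x k - η • gradient f (x k)

/-- The path length `∫₀^∞ ‖x'(t)‖ dt` of a curve on `[0, ∞)`, as an element of `[0, ∞]`. -/
noncomputable def flowPathLength {d : ℕ} (x : ℝ → EuclideanSpace ℝ (Fin d)) : ℝ≥0∞ :=
  ∫⁻ t in Ici (0 : ℝ), ‖derivWithin x (Ici 0) t‖ₑ

/-- The path length `∑ₖ ‖xₖ - xₖ₊₁‖` of a sequence, as an element of `[0, ∞]`. -/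
noncomputable def descentPathLength {d : ℕ} (x : ℕ → EuclideanSpace ℝ (Fin d)) : ℝ≥0∞ :=
  ∑' k : ℕ, ‖x k - x (k + 1)‖ₑ

/-! Both methods are Fejér monotone: they never move away from a point whose value is at most the
current one. Applied to later points of the trajectory itself, this says that the trajectory is
self-contracted; applied to a cluster point, which exists because a minimiser keeps the trajectory
bounded, it gives convergence to some `z`.

From any point of a self-contracted curve, the secants to the later points are pairwise non-obtuse,
so they lie in a circular cone about a unit vector `ξ` with half-angle `arccos (1 / √n)`
(`exists_unit_norm_le_sqrt_mul_inner`). For directions `v` near `-ξ` the current point maximises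
`⟪v, ·⟫` over the tail of the curve, so the support function of the tail drops as the curve moves
on. Averaged over a fixed measure `μ` on directions, it becomes a potential, `meanSupport`, which
never increases, loses at least a fixed multiple of the length travelled, and loses in all at most
`(∫ ‖v‖ ∂μ) * ‖x 0 - z‖`. This bounds the length, by `SelfContractedOn.sum_norm_sub_le` for
sequences and `SelfContractedOn.integral_norm_deriv_le` for flows.

The measure `μ` is Lebesgue measure on a ball of radius `1 + ρ`, which contains the ball of radius
`ρ` about every `-ξ`. For the `d log d` bounds this is too lossy when `d = 2`, where the uniform
measure on the circle replaces it. When `d = 1` those bounds have constant 1, and the motion is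
shown to be monotone towards `z`. -/

open scoped RealInnerProductSpace
open Module (finrank)

/-! ### Pairwise acute vectors lie in a circular cone. -/

section Direction

variable {E : Type*} [NormedAddCommGroup E] [InnerProductSpace ℝ E]

/-- Affinely independent points of a hyperplane that misses the origin are linearly independent. -/
theorem AffineIndependent.linearIndependent_of_inner_eq {ι : Type*} {z : ι → E}
    (hz : AffineIndependent ℝ z) {p : E} {c : ℝ} (hc : c ≠ 0) (h : ∀ i, ⟪p, z i⟫ = c) :
    LinearIndependent ℝ z := by
  rw [linearIndependent_iff']
  intro s g hg
  have h0 : ∑ i ∈ s, g i = 0 := by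
    have h1 : ⟪p, ∑ i ∈ s, g i • z i⟫ = 0 := by rw [hg, inner_zero_right]
    simp only [inner_sum, inner_smul_right, h, ← Finset.sum_mul] at h1
    exact (mul_eq_zero.1 h1).resolve_right hc
  exact (affineIndependent_iff.1 hz) s g h0 hg

variable [FiniteDimensional ℝ E]

/-- The axis is the normalised point `p` of least norm in the convex hull, since `⟪p, a⟫ ≥ ‖p‖ ^ 2`
there. It remains to see `‖p‖ ^ 2 ≥ 1 / n`. In a Carathéodory representation of `p`, acuteness makes
`⟪p, z i⟫` at least the weight `w i`, so `‖p‖ ^ 2` is at least the sum of squared weights;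
Cauchy-Schwarz bounds this below by one over the number of points. -/
theorem exists_unit_inner_ge_of_finite {U : Set E} (hU : U.Finite) (hne : U.Nonempty)
    (h1 : ∀ a ∈ U, ‖a‖ = 1) (hpos : ∀ a ∈ U, ∀ b ∈ U, 0 ≤ ⟪a, b⟫) :
    ∃ ξ : E, ‖ξ‖ = 1 ∧ ∀ a ∈ U, 1 ≤ √(finrank ℝ E) * ⟪ξ, a⟫ := by
  have hcv : Convex ℝ (convexHull ℝ U) := convex_convexHull ℝ U
  obtain ⟨p, hp, hmin⟩ := exists_norm_eq_iInf_of_complete_convex (hne.convexHull)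
    (hU.isCompact_convexHull ℝ).isComplete hcv 0
  rw [norm_eq_iInf_iff_real_inner_le_zero hcv hp] at hmin
  have hmin' : ∀ w ∈ convexHull ℝ U, ‖p‖ ^ 2 ≤ ⟪p, w⟫ := by
    intro w hw
    have := hmin w hw
    rw [zero_sub, inner_neg_left, inner_sub_right, real_inner_self_eq_norm_sq] at this
    linarith
  obtain ⟨ι, hι, z, w, hzU, hz, hw, hw1, hwz⟩ := eq_pos_convex_span_of_mem_convexHull hp
  have hzU' : ∀ i, z i ∈ U := fun i => hzU (mem_range_self i)
  have hge : ∀ i, w i ≤ ⟪p, z i⟫ := by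
    intro i
    rw [← hwz, sum_inner]
    calc w i = ⟪w i • z i, z i⟫ := by
          rw [real_inner_smul_left, real_inner_self_eq_norm_sq, h1 _ (hzU' i)]; simp
      _ ≤ _ := Finset.single_le_sum (f := fun j => ⟪w j • z j, z i⟫) (fun j _ => by
          rw [real_inner_smul_left]
          exact mul_nonneg (hw j).le (hpos _ (hzU' j) _ (hzU' i))) (Finset.mem_univ i)
  have hpp : ∑ i, w i * ⟪p, z i⟫ = ‖p‖ ^ 2 := by
    rw [← real_inner_self_eq_norm_sq]
    conv_rhs => rw [← hwz, inner_sum]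
    simp [hwz, inner_smul_right]
  have hcard : 1 ≤ (Fintype.card ι : ℝ) * ‖p‖ ^ 2 := by
    have h2 := sq_sum_le_card_mul_sum_sq (s := Finset.univ) (f := w)
    rw [hw1, one_pow, Finset.card_univ] at h2
    refine h2.trans ?_
    rw [← hpp]
    gcongr with i
    rw [sq]
    exact mul_le_mul_of_nonneg_left (hge i) (hw i).le
  have hp0 : 0 < ‖p‖ := by
    rcases (norm_nonneg p).eq_or_lt with h | h
    · rw [← h] at hcard; norm_num at hcard
    · exact h
  -- Complementary slackness puts every `z i` on one hyperplane missing the origin; linear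
  -- independence then allows only `n` points, rather than `n + 1`.
  have heq : ∀ i, ⟪p, z i⟫ = ‖p‖ ^ 2 := by
    have h3 : ∑ i, w i * (⟪p, z i⟫ - ‖p‖ ^ 2) = 0 := by
      simp only [mul_sub, Finset.sum_sub_distrib, hpp, ← Finset.sum_mul, hw1]; ring
    have h4 : ∀ i, 0 ≤ ⟪p, z i⟫ - ‖p‖ ^ 2 := fun i =>
      sub_nonneg.2 (hmin' _ (subset_convexHull ℝ U (hzU' i)))
    rw [Finset.sum_eq_zero_iff_of_nonneg (fun i _ => mul_nonneg (hw i).le (h4 i))] at h3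
    intro i
    have := (mul_eq_zero.1 (h3 i (Finset.mem_univ i))).resolve_left (hw i).ne'
    linarith
  have hn : Fintype.card ι ≤ finrank ℝ E :=
    (hz.linearIndependent_of_inner_eq (by positivity) heq).fintype_card_le_finrank
  have hn' : 1 ≤ √(finrank ℝ E) * ‖p‖ := by
    rw [← Real.sqrt_sq hp0.le, ← Real.sqrt_mul (by positivity), Real.one_le_sqrt]
    refine hcard.trans ?_
    gcongr
  refine ⟨‖p‖⁻¹ • p, by rw [norm_smul, norm_inv, norm_norm, inv_mul_cancel₀ hp0.ne'], ?_⟩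
  intro a ha
  refine hn'.trans ?_
  gcongr
  rw [real_inner_smul_left, le_inv_mul_iff₀ hp0, ← sq]
  exact hmin' a (subset_convexHull ℝ U ha)

/-- A family of pairwise acute vectors lies in a circular cone of half-angle `arccos (1 / √n)`. -/
theorem exists_unit_norm_le_sqrt_mul_inner [Nontrivial E] {S : Set E}
    (hS : ∀ a ∈ S, ∀ b ∈ S, 0 ≤ ⟪a, b⟫) :
    ∃ ξ : E, ‖ξ‖ = 1 ∧ ∀ a ∈ S, ‖a‖ ≤ √(finrank ℝ E) * ⟪ξ, a⟫ := by
  have hcl : ∀ a : S, IsClosed {ξ : E | ‖(a : E)‖ ≤ √(finrank ℝ E) * ⟪ξ, (a : E)⟫} := fun a =>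
    isClosed_le (by fun_prop) (by fun_prop)
  -- Compactness of the sphere reduces the claim to finite subfamilies.
  have := (isCompact_sphere (0 : E) 1).inter_iInter_nonempty _ hcl ?_
  · obtain ⟨ξ, hξ, h⟩ := this
    refine ⟨ξ, by simpa using hξ, fun a ha => ?_⟩
    simpa using mem_iInter.1 h ⟨a, ha⟩
  intro u
  classical
  set U : Set E := (fun a : S => ‖(a : E)‖⁻¹ • (a : E)) '' {a | a ∈ u ∧ (a : E) ≠ 0} with hUdef
  have hUf : U.Finite := (u.finite_toSet.subset fun a ha => ha.1).image _
  rcases U.eq_empty_or_nonempty with hU | hU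
  · obtain ⟨ξ, hξ⟩ := exists_norm_eq E zero_le_one
    refine ⟨ξ, by simpa using hξ, mem_iInter₂.2 fun a ha => ?_⟩
    have : (a : E) = 0 := by
      by_contra h0
      have : ‖(a : E)‖⁻¹ • (a : E) ∈ U := ⟨a, ⟨ha, h0⟩, rfl⟩
      rwa [hU] at this
    simp [this]
  · have hU1 : ∀ a ∈ U, ‖a‖ = 1 := by
      rintro _ ⟨a, ⟨-, h0⟩, rfl⟩
      rw [norm_smul, norm_inv, norm_norm, inv_mul_cancel₀ (norm_ne_zero_iff.2 h0)]
    have hUpos : ∀ a ∈ U, ∀ b ∈ U, 0 ≤ ⟪a, b⟫ := by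
      rintro _ ⟨a, -, rfl⟩ _ ⟨b, -, rfl⟩
      simp only [real_inner_smul_left, real_inner_smul_right]
      have := hS _ a.2 _ b.2
      positivity
    obtain ⟨ξ, hξ, h⟩ := exists_unit_inner_ge_of_finite hUf hU hU1 hUpos
    refine ⟨ξ, by simpa using hξ, mem_iInter₂.2 fun a ha => ?_⟩
    by_cases h0 : (a : E) = 0
    · simp [h0]
    have h2 := h _ ⟨a, ⟨ha, h0⟩, rfl⟩
    have h3 : 0 < ‖(a : E)‖ := norm_pos_iff.2 h0
    simp only [real_inner_smul_right] at h2
    have h4 := mul_le_mul_of_nonneg_left h2 h3.le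
    rw [mul_one] at h4
    refine h4.trans (le_of_eq ?_)
    field_simp

end Direction

/-! ### Support functions and their averages over directions. -/

section Support

variable {E : Type*} [NormedAddCommGroup E] [InnerProductSpace ℝ E]

/-- The support function of a set. -/
noncomputable def supportFn (K : Set E) (v : E) : ℝ := ⨆ a : K, ⟪v, (a : E)⟫

variable {K L : Set E} {v : E}

theorem inner_le_supportFn (hK : Bornology.IsBounded K) {a : E} (ha : a ∈ K) :
    ⟪v, a⟫ ≤ supportFn K v := by
  obtain ⟨R, hR⟩ := hK.exists_norm_le
  refine le_ciSup (f := fun a : K => ⟪v, (a : E)⟫) ⟨‖v‖ * R, ?_⟩ ⟨a, ha⟩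
  rintro _ ⟨b, rfl⟩
  exact (real_inner_le_norm _ _).trans (mul_le_mul_of_nonneg_left (hR _ b.2) (norm_nonneg _))

theorem inner_le_supportFn_of_mem_closure (hK : Bornology.IsBounded K) {a : E}
    (ha : a ∈ closure K) : ⟪v, a⟫ ≤ supportFn K v :=
  closure_minimal (t := {b | ⟪v, b⟫ ≤ supportFn K v}) (fun _ hb => inner_le_supportFn hK hb)
    (isClosed_le (by fun_prop) (by fun_prop)) ha

theorem supportFn_le (hne : K.Nonempty) {c : ℝ} (h : ∀ a ∈ K, ⟪v, a⟫ ≤ c) : supportFn K v ≤ c :=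
  haveI := hne.to_subtype
  ciSup_le fun a => h a a.2

theorem supportFn_mono (hne : K.Nonempty) (hL : Bornology.IsBounded L) (h : K ⊆ L) :
    supportFn K v ≤ supportFn L v :=
  supportFn_le hne fun _ ha => inner_le_supportFn hL (h ha)

/-- The closure is needed because the limit of the curve, which serves as `b`, need not lie on it.
-/
theorem supportFn_le_add (hne : K.Nonempty) (hL : Bornology.IsBounded L) {r : ℝ}
    (h : ∀ a ∈ K, ∃ b ∈ closure L, ‖a - b‖ ≤ r) : supportFn K v ≤ supportFn L v + r * ‖v‖ := by
  refine supportFn_le hne fun a ha => ?_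
  obtain ⟨b, hb, hab⟩ := h a ha
  calc ⟪v, a⟫ = ⟪v, b⟫ + ⟪v, a - b⟫ := by rw [inner_sub_right]; ring
    _ ≤ supportFn L v + r * ‖v‖ := by
      refine add_le_add (inner_le_supportFn_of_mem_closure hL hb) ?_
      rw [mul_comm]
      exact (real_inner_le_norm _ _).trans (mul_le_mul_of_nonneg_left hab (norm_nonneg _))

theorem continuous_supportFn (hne : K.Nonempty) (hK : Bornology.IsBounded K) :
    Continuous (supportFn K) := by
  obtain ⟨R, hR⟩ := hK.exists_norm_le
  have hR0 : 0 ≤ R := (norm_nonneg _).trans (hR _ hne.some_mem)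
  refine (LipschitzWith.of_le_add_mul ⟨R, hR0⟩ fun v w => supportFn_le hne fun a ha => ?_).continuous
  calc ⟪v, a⟫ = ⟪w, a⟫ + ⟪v - w, a⟫ := by rw [inner_sub_left]; ring
    _ ≤ supportFn K w + R * dist v w := by
      refine add_le_add (inner_le_supportFn hK ha) ?_
      rw [mul_comm, dist_eq_norm]
      exact (real_inner_le_norm _ _).trans (mul_le_mul_of_nonneg_left (hR a ha) (norm_nonneg _))

variable [MeasurableSpace E] [BorelSpace E]

theorem integrable_supportFn {μ : Measure E} (hμ : Integrable id μ) (hne : K.Nonempty)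
    (hK : Bornology.IsBounded K) : Integrable (supportFn K) μ := by
  obtain ⟨R, hR⟩ := hK.exists_norm_le
  refine (hμ.norm.const_mul R).mono' (continuous_supportFn hne hK).aestronglyMeasurable
    (ae_of_all _ fun v => ?_)
  have hb : ∀ a ∈ K, |⟪v, a⟫| ≤ R * ‖v‖ := fun a ha => by
    rw [mul_comm]
    exact (abs_real_inner_le_norm _ _).trans (mul_le_mul_of_nonneg_left (hR a ha) (norm_nonneg _))
  rw [Real.norm_eq_abs, abs_le]
  obtain ⟨a, ha⟩ := hne
  exact ⟨(abs_le.1 (hb a ha)).1.trans (inner_le_supportFn hK ha),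
    supportFn_le ⟨a, ha⟩ fun b hb' => (abs_le.1 (hb b hb')).2⟩

/-- The support function of a set, averaged over a measure on the space of directions. -/
noncomputable def meanSupport (μ : Measure E) (K : Set E) : ℝ := ∫ v, supportFn K v ∂μ

theorem meanSupport_le_add {μ : Measure E} (hμ : Integrable id μ) (hKne : K.Nonempty)
    (hK : Bornology.IsBounded K) (hLne : L.Nonempty) (hL : Bornology.IsBounded L) {r : ℝ}
    (h : ∀ a ∈ K, ∃ b ∈ closure L, ‖a - b‖ ≤ r) :
    meanSupport μ K ≤ meanSupport μ L + (∫ v, ‖v‖ ∂μ) * r := by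
  have hL' := integrable_supportFn hμ hLne hL
  have hn : Integrable (fun v : E => r * ‖v‖) μ := hμ.norm.const_mul r
  rw [mul_comm, ← integral_const_mul, meanSupport, meanSupport, ← integral_add hL' hn]
  exact integral_mono (integrable_supportFn hμ hKne hK) (hL'.add hn)
    fun v => supportFn_le_add hKne hL h

/-- The drop is nonnegative in every direction, so integrating it only over the favourable part `ν`
of `μ` gives a lower bound. -/
theorem integral_le_meanSupport_sub {μ ν : Measure E} (hμ : Integrable id μ) (hν : ν ≤ μ)
    (hLne : L.Nonempty) (hK : Bornology.IsBounded K) (hLK : L ⊆ K) {g : E → ℝ}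
    (hg : Integrable g ν) (h : ∀ᵐ v ∂ν, supportFn L v + g v ≤ supportFn K v) :
    ∫ v, g v ∂ν ≤ meanSupport μ K - meanSupport μ L := by
  have hK' := integrable_supportFn hμ (hLne.mono hLK) hK
  have hL' := integrable_supportFn hμ hLne (hK.subset hLK)
  rw [meanSupport, meanSupport, ← integral_sub hK' hL']
  refine (integral_mono_ae hg ((hK'.sub hL').mono_measure hν) ?_).trans
    (integral_mono_measure hν (ae_of_all _ fun v => ?_) (hK'.sub hL'))
  · filter_upwards [h] with v hv
    simp only [Pi.sub_apply]
    linarith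
  · exact sub_nonneg.2 (supportFn_mono hLne hK hLK)

end Support

/-! ### Self-contracted curves and the length of sequences. -/

section SelfContracted

variable {E : Type*} [NormedAddCommGroup E] [InnerProductSpace ℝ E]
  {T : Type*} [LinearOrder T] {x : T → E} {I : Set T}

/-- Along a self-contracted curve the distance to every later point decreases. -/
def SelfContractedOn (x : T → E) (I : Set T) : Prop :=
  ∀ r ∈ I, ∀ s, r ≤ s → ∀ t, s ≤ t → ‖x s - x t‖ ≤ ‖x r - x t‖

/-- This is self-contractedness squared and expanded about `x r`. -/
theorem SelfContractedOn.sq_norm_le_inner (hx : SelfContractedOn x I) {r s t : T} (hr : r ∈ I)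
    (hrs : r ≤ s) (hst : s ≤ t) : ‖x s - x r‖ ^ 2 / 2 ≤ ⟪x s - x r, x t - x r⟫ := by
  have h := pow_le_pow_left₀ (norm_nonneg _) (hx r hr s hrs t hst) 2
  have h1 : x s - x t = (x s - x r) - (x t - x r) := by abel
  rw [h1, norm_sub_sq_real, norm_sub_rev (x r)] at h
  linarith

theorem SelfContractedOn.inner_nonneg (hx : SelfContractedOn x I) {r s t : T} (hr : r ∈ I)
    (hrs : r ≤ s) (hrt : r ≤ t) : 0 ≤ ⟪x s - x r, x t - x r⟫ := by
  rcases le_total s t with h | h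
  · exact (by positivity : (0 : ℝ) ≤ ‖x s - x r‖ ^ 2 / 2).trans (hx.sq_norm_le_inner hr hrs h)
  · rw [real_inner_comm]
    exact (by positivity : (0 : ℝ) ≤ ‖x t - x r‖ ^ 2 / 2).trans (hx.sq_norm_le_inner hr hrt h)

theorem SelfContractedOn.norm_le_two_mul (hx : SelfContractedOn x I) {r s t : T} (hr : r ∈ I)
    (hrs : r ≤ s) (hst : s ≤ t) : ‖x s - x r‖ ≤ 2 * ‖x t - x r‖ := by
  have h := (hx.sq_norm_le_inner hr hrs hst).trans (real_inner_le_norm _ _)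
  rcases (norm_nonneg (x s - x r)).eq_or_lt with h0 | h0
  · rw [← h0]; positivity
  · nlinarith

omit [InnerProductSpace ℝ E] in
theorem SelfContractedOn.norm_sub_lim_le [Nonempty T] (hx : SelfContractedOn x I) {z : E}
    (hz : Tendsto x atTop (𝓝 z)) {r s : T} (hr : r ∈ I) (hrs : r ≤ s) :
    ‖x s - z‖ ≤ ‖x r - z‖ :=
  le_of_tendsto_of_tendsto (hz.const_sub (x s)).norm (hz.const_sub (x r)).norm
    ((eventually_ge_atTop s).mono fun t ht => hx r hr s hrs t ht)

omit [InnerProductSpace ℝ E] in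
theorem SelfContractedOn.isBounded_image_Ici [Nonempty T] (hx : SelfContractedOn x I) {z : E}
    (hz : Tendsto x atTop (𝓝 z)) {r : T} (hr : r ∈ I) : Bornology.IsBounded (x '' Ici r) := by
  refine (Metric.isBounded_closedBall (x := z) (r := ‖x r - z‖)).subset ?_
  rintro _ ⟨s, hs, rfl⟩
  rw [mem_closedBall_iff_norm]
  exact hx.norm_sub_lim_le hz hr hs

omit [InnerProductSpace ℝ E] in
theorem mem_closure_image_Ici [Nonempty T] {z : E} (hz : Tendsto x atTop (𝓝 z)) (r : T) :
    z ∈ closure (x '' Ici r) :=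
  mem_closure_of_tendsto hz ((eventually_ge_atTop r).mono fun _ ht => mem_image_of_mem x ht)

/-- The limit `z` is in the closure of every tail, and the tail from `r` stays within `‖x r - z‖` of
it. This caps the total loss of the potential. -/
theorem SelfContractedOn.meanSupport_le [Nonempty T] [MeasurableSpace E] [BorelSpace E]
    {μ : Measure E} (hμ : Integrable id μ) (hx : SelfContractedOn x I)
    {z : E} (hz : Tendsto x atTop (𝓝 z)) {r s : T} (hr : r ∈ I) (hrs : r ≤ s) :
    meanSupport μ (x '' Ici r) ≤ meanSupport μ (x '' Ici s) + (∫ v, ‖v‖ ∂μ) * ‖x r - z‖ := by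
  have hb := hx.isBounded_image_Ici hz hr
  refine meanSupport_le_add hμ (nonempty_Ici.image x) hb (nonempty_Ici.image x)
    (hb.subset (image_mono (Ici_subset_Ici.2 hrs))) ?_
  rintro _ ⟨t, ht, rfl⟩
  exact ⟨z, mem_closure_image_Ici hz s, hx.norm_sub_lim_le hz hr ht⟩

variable [FiniteDimensional ℝ E] [Nontrivial E] [MeasurableSpace E] [BorelSpace E]

/-- Length bound for self-contracted sequences, in terms of a measure on directions that charges
the interior of every polar cone. -/
theorem SelfContractedOn.sum_norm_sub_le {x : ℕ → E} (hx : SelfContractedOn x univ) {z : E}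
    (hz : Tendsto x atTop (𝓝 z)) {μ : Measure E} [IsFiniteMeasure μ] (hμ : Integrable id μ)
    {κ m : ℝ} (hκ : 0 ≤ κ)
    (H : ∀ ξ : E, ‖ξ‖ = 1 → ∃ ν ≤ μ, m ≤ ν.real univ ∧
      ∀ᵐ v ∂ν, ∀ a : E, ‖a‖ ≤ √(finrank ℝ E) * ⟪ξ, a⟫ → ⟪v, a⟫ ≤ -(κ * ‖a‖)) (N : ℕ) :
    m * κ * ∑ k ∈ Finset.range N, ‖x k - x (k + 1)‖ ≤ 2 * (∫ v, ‖v‖ ∂μ) * ‖x 0 - z‖ := by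
  have hstep : ∀ k, m * κ * ‖x k - x (k + 1)‖ ≤
      2 * (meanSupport μ (x '' Ici k) - meanSupport μ (x '' Ici (k + 1))) := by
    intro k
    obtain ⟨ξ, hξ, hcone⟩ := exists_unit_norm_le_sqrt_mul_inner
      (S := (fun j => x j - x k) '' Ici k) (by
        rintro _ ⟨s, hs, rfl⟩ _ ⟨t, ht, rfl⟩
        exact hx.inner_nonneg (mem_univ k) hs ht)
    obtain ⟨ν, hν, hm, hpol⟩ := H ξ hξ
    have : IsFiniteMeasure ν := isFiniteMeasure_of_le μ hν
    have hb := hx.isBounded_image_Ici hz (mem_univ k)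
    have hdrop := integral_le_meanSupport_sub (K := x '' Ici k) (L := x '' Ici (k + 1))
      hμ hν (nonempty_Ici.image x) hb (image_mono (Ici_subset_Ici.2 k.le_succ))
      (integrable_const (κ * (‖x k - x (k + 1)‖ / 2))) ?_
    · rw [integral_const, smul_eq_mul] at hdrop
      have := mul_le_mul_of_nonneg_right hm
        (by positivity : 0 ≤ κ * (‖x k - x (k + 1)‖ / 2))
      linarith
    · filter_upwards [hpol] with v hv
      rw [← le_sub_iff_add_le]
      refine supportFn_le (nonempty_Ici.image x) ?_
      rintro _ ⟨j, hj, rfl⟩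
      have hkj : k ≤ j := k.le_succ.trans hj
      have h1 := hv _ (hcone _ ⟨j, hkj, rfl⟩)
      -- Every later point is at least half a step away from `x k`, so the margin `κ` yields a drop
      -- uniform over the remaining tail.
      have h2 := hx.norm_le_two_mul (mem_univ k) k.le_succ hj
      have h3 : ⟪v, x k⟫ ≤ supportFn (x '' Ici k) v :=
        inner_le_supportFn hb (mem_image_of_mem x self_mem_Ici)
      rw [inner_sub_right] at h1
      rw [norm_sub_rev, Nat.succ_eq_add_one] at h2
      have h4 := mul_le_mul_of_nonneg_left h2 hκ
      linarith
  rw [Finset.mul_sum]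
  refine (Finset.sum_le_sum fun k _ => hstep k).trans ?_
  rw [← Finset.mul_sum, Finset.sum_range_sub']
  have := hx.meanSupport_le hμ hz (mem_univ 0) N.zero_le
  linarith

end SelfContracted

/-! ### Length of differentiable self-contracted curves. -/

section Flow

variable {E : Type*} [NormedAddCommGroup E] [InnerProductSpace ℝ E]
  [MeasurableSpace E] [BorelSpace E]

theorem SelfContractedOn.meanSupport_image_Ici_antitone {x : ℝ → E}
    (hx : SelfContractedOn x (Ici 0)) {z : E} (hz : Tendsto x atTop (𝓝 z)) {μ : Measure E}
    (hμ : Integrable id μ) {r s : ℝ} (hr : 0 ≤ r) (hrs : r ≤ s) :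
    meanSupport μ (x '' Ici s) ≤ meanSupport μ (x '' Ici r) := by
  have hb := hx.isBounded_image_Ici hz hr
  have hsub : x '' Ici s ⊆ x '' Ici r := image_mono (Ici_subset_Ici.2 hrs)
  exact integral_mono (integrable_supportFn hμ (nonempty_Ici.image x) (hb.subset hsub))
    (integrable_supportFn hμ (nonempty_Ici.image x) hb)
    fun v => supportFn_mono (nonempty_Ici.image x) hb hsub

theorem SelfContractedOn.abs_meanSupport_sub_le {x : ℝ → E}
    (hx : SelfContractedOn x (Ici 0)) {z : E} (hz : Tendsto x atTop (𝓝 z)) {μ : Measure E}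
    (hμ : Integrable id μ) {r s : ℝ} (hr : 0 ≤ r) (hs : 0 ≤ s) :
    |meanSupport μ (x '' Ici r) - meanSupport μ (x '' Ici s)| ≤
      (∫ v, ‖v‖ ∂μ) * ‖x r - x s‖ := by
  wlog hrs : r ≤ s generalizing r s
  · rw [abs_sub_comm, norm_sub_rev]
    exact this hs hr (le_of_not_ge hrs)
  rw [abs_of_nonneg (sub_nonneg.2 (hx.meanSupport_image_Ici_antitone hz hμ hr hrs)),
    sub_le_iff_le_add']
  refine meanSupport_le_add hμ (nonempty_Ici.image x) (hx.isBounded_image_Ici hz hr)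
    (nonempty_Ici.image x) (hx.isBounded_image_Ici hz hs) ?_
  rintro _ ⟨t, ht, rfl⟩
  rcases le_total t s with h | h
  · exact ⟨x s, subset_closure (mem_image_of_mem x self_mem_Ici), hx r hr t ht s h⟩
  · exact ⟨x t, subset_closure (mem_image_of_mem x h), by simp⟩

variable [FiniteDimensional ℝ E] [Nontrivial E]

/-- Length bound for smooth self-contracted curves, in terms of a measure on directions whose
restrictions to polar cones have a barycentre on the axis. -/
theorem SelfContractedOn.integral_norm_deriv_le {x g : ℝ → E} (hx : SelfContractedOn x (Ici 0))
    (hder : ∀ t, 0 ≤ t → HasDerivWithinAt x (g t) (Ici 0) t) (hg : Continuous g)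
    (hacute : ∀ s, 0 ≤ s → ∀ t, s ≤ t → 0 ≤ ⟪g s, x t - x s⟫) {z : E}
    (hz : Tendsto x atTop (𝓝 z)) {μ : Measure E} (hμ : Integrable id μ) {m : ℝ} (hm : 0 ≤ m)
    (H : ∀ ξ : E, ‖ξ‖ = 1 → ∃ ν ≤ μ,
      (∀ᵐ v ∂ν, ∀ a : E, ‖a‖ ≤ √(finrank ℝ E) * ⟪ξ, a⟫ → ⟪v, a⟫ ≤ 0) ∧
      ∀ e : E, ∫ v, ⟪v, e⟫ ∂ν = -(m * ⟪ξ, e⟫)) {T : ℝ} (hT : 0 ≤ T) :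
    m * ∫ t in (0 : ℝ)..T, ‖g t‖ ≤ √(finrank ℝ E) * (∫ v, ‖v‖ ∂μ) * ‖x 0 - z‖ := by
  set Φ : ℝ → ℝ := fun t => meanSupport μ (x '' Ici t) with hΦ
  have hn : 0 < √(finrank ℝ E : ℝ) := Real.sqrt_pos.2 (Nat.cast_pos.2 Module.finrank_pos)
  have hdrop : ∀ s, 0 ≤ s → ∃ ξ : E, ‖g s‖ ≤ √(finrank ℝ E) * ⟪ξ, g s⟫ ∧
      ∀ t, 0 ≤ t → t ≤ s → m * ⟪ξ, x s - x t⟫ ≤ Φ t - Φ s := by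
    intro s hs
    -- The cone sits at the later time `s`, so one axis serves all earlier `t`. The velocity joins
    -- the secants so that the axis also controls `‖g s‖`.
    obtain ⟨ξ, hξ, hcone⟩ := exists_unit_norm_le_sqrt_mul_inner
      (S := insert (g s) ((fun t => x t - x s) '' Ici s)) (by
        rintro _ (rfl | ⟨r, hr, rfl⟩) _ (rfl | ⟨t, ht, rfl⟩)
        · exact real_inner_self_nonneg
        · exact hacute s hs t ht
        · rw [real_inner_comm]; exact hacute s hs r hr
        · exact hx.inner_nonneg hs hr ht)
    refine ⟨ξ, hcone _ (mem_insert _ _), fun t ht hts => ?_⟩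
    obtain ⟨ν, hν, hpol, hbar⟩ := H ξ hξ
    have hb := hx.isBounded_image_Ici hz ht
    have hsub : x '' Ici s ⊆ x '' Ici t := image_mono (Ici_subset_Ici.2 hts)
    have h1 := integral_le_meanSupport_sub (g := fun v => ⟪v, x t - x s⟫) hμ hν
      (nonempty_Ici.image x) hb hsub ((hμ.mono_measure hν).inner_const _) ?_
    · rw [hbar, ← mul_neg, ← inner_neg_right, neg_sub] at h1
      exact h1
    · filter_upwards [hpol] with v hv
      rw [← le_sub_iff_add_le]
      refine supportFn_le (nonempty_Ici.image x) ?_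
      rintro _ ⟨u, hu, rfl⟩
      have h2 := hv _ (hcone _ (mem_insert_of_mem _ ⟨u, hu, rfl⟩))
      have h3 : ⟪v, x t⟫ ≤ supportFn (x '' Ici t) v :=
        inner_le_supportFn hb (mem_image_of_mem x self_mem_Ici)
      simp only [inner_sub_right] at h2 ⊢
      linarith
  -- The drop estimate controls left difference quotients of `Φ`; reversing time turns them into the
  -- right ones needed for the comparison principle.
  have hxc : ContinuousOn (fun τ => x (T - τ)) (Icc 0 T) := by
    have h1 : ContinuousOn x (Ici 0) := fun t ht => (hder t ht).continuousWithinAt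
    exact h1.comp (by fun_prop) fun τ hτ => sub_nonneg.2 hτ.2
  have hFc : ContinuousOn (fun τ => -Φ (T - τ)) (Icc 0 T) := by
    refine ContinuousOn.neg fun τ hτ => ?_
    rw [ContinuousWithinAt, tendsto_iff_dist_tendsto_zero]
    have h1 : Tendsto (fun σ => (∫ v, ‖v‖ ∂μ) * ‖x (T - σ) - x (T - τ)‖) (𝓝[Icc 0 T] τ) (𝓝 0) := by
      have := ((hxc τ hτ).sub_const (x (T - τ))).norm.const_mul (∫ v, ‖v‖ ∂μ)
      simpa using this
    refine squeeze_zero' (Eventually.of_forall fun _ => dist_nonneg) ?_ h1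
    filter_upwards [self_mem_nhdsWithin] with σ hσ
    exact hx.abs_meanSupport_sub_le hz hμ (sub_nonneg.2 hσ.2) (sub_nonneg.2 hτ.2)
  set c : ℝ := m / √(finrank ℝ E) with hc
  set B : ℝ → ℝ := fun τ => -Φ T - c * ∫ u in (0 : ℝ)..τ, ‖g (T - u)‖ with hB
  have hBd : ∀ τ, HasDerivAt B (-(c * ‖g (T - τ)‖)) τ := by
    intro τ
    have h1 : Continuous fun u => ‖g (T - u)‖ := by fun_prop
    have h2 := (h1.integral_hasStrictDerivAt 0 τ).hasDerivAt
    exact ((h2.const_mul c).const_sub (-Φ T))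
  have key := image_le_of_liminf_slope_right_le_deriv_boundary (f := fun τ => -Φ (T - τ)) hFc
    (B := B) (B' := fun τ => -(c * ‖g (T - τ)‖)) (by simp [hB])
    (fun τ _ => (hBd τ).continuousAt.continuousWithinAt)
    (fun τ _ => (hBd τ).hasDerivWithinAt) ?_ (right_mem_Icc.2 hT)
  · have h1 : ∫ u in (0 : ℝ)..T, ‖g (T - u)‖ = ∫ u in (0 : ℝ)..T, ‖g u‖ := by
      rw [intervalIntegral.integral_comp_sub_left (fun u => ‖g u‖)]
      simp
    simp only [hB, h1, sub_self] at key
    have h2 : Φ 0 ≤ Φ T + (∫ v, ‖v‖ ∂μ) * ‖x 0 - z‖ := hx.meanSupport_le hμ hz self_mem_Ici hT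
    have h3 : c * ∫ u in (0 : ℝ)..T, ‖g u‖ ≤ (∫ v, ‖v‖ ∂μ) * ‖x 0 - z‖ := by linarith
    rw [hc, div_mul_eq_mul_div, div_le_iff₀ hn] at h3
    linarith
  · intro τ hτ r hr
    have hs : 0 < T - τ := sub_pos.2 hτ.2
    obtain ⟨ξ, hξg, hξ⟩ := hdrop (T - τ) hs.le
    have hxd : HasDerivAt x (g (T - τ)) (T - τ) :=
      (hder _ hs.le).hasDerivAt (Ici_mem_nhds hs)
    have hy : HasDerivAt (fun σ => x (T - σ)) (-g (T - τ)) τ := by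
      simpa [Function.comp_def] using hxd.scomp τ ((hasDerivAt_id τ).const_sub T)
    have hw : HasDerivAt (fun σ => m * ⟪ξ, x (T - σ)⟫) (m * ⟪ξ, -g (T - τ)⟫) τ := by
      have := ((hasDerivAt_const τ ξ).inner ℝ hy).const_mul m
      simpa using this
    have hlt : m * ⟪ξ, -g (T - τ)⟫ < r := by
      refine lt_of_le_of_lt ?_ hr
      rw [inner_neg_right, mul_neg, neg_le_neg_iff, hc, div_mul_eq_mul_div, div_le_iff₀ hn]
      have := mul_le_mul_of_nonneg_left hξg hm
      linarith
    have hev := (hasDerivAt_iff_tendsto_slope.1 hw).eventually_lt_const hlt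
    refine Eventually.frequently ?_
    filter_upwards [hev.filter_mono (nhdsWithin_mono τ fun y (hy : τ < y) => hy.ne'),
      Ioo_mem_nhdsGT hτ.2] with y hy1 hy2
    refine lt_of_le_of_lt ?_ hy1
    simp only [slope_def_field]
    have h1 := hξ (T - y) (by linarith [hy2.2]) (by linarith [hy2.1])
    rw [inner_sub_right] at h1
    have h2 : 0 < y - τ := sub_pos.2 hy2.1
    refine div_le_div_of_nonneg_right ?_ h2.le
    linarith

end Flow

/-! ### Lebesgue measure on balls as the measure on directions. -/

section Ball

variable {E : Type*} [NormedAddCommGroup E] [InnerProductSpace ℝ E] [FiniteDimensional ℝ E]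
  [MeasurableSpace E] [BorelSpace E]

theorem integrable_id_restrict_closedBall (R : ℝ) :
    Integrable id ((volume : Measure E).restrict (Metric.closedBall 0 R)) :=
  continuous_id.continuousOn.integrableOn_compact (isCompact_closedBall 0 R)

theorem integral_norm_restrict_closedBall_le {R : ℝ} (hR : 0 ≤ R) :
    ∫ v, ‖v‖ ∂((volume : Measure E).restrict (Metric.closedBall 0 R)) ≤
      R ^ (finrank ℝ E + 1) * volume.real (Metric.closedBall (0 : E) 1) := by
  have h1 : ∫ v in Metric.closedBall (0 : E) R, ‖v‖ ≤ ∫ _ in Metric.closedBall (0 : E) R, R := by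
    refine setIntegral_mono_on (integrable_id_restrict_closedBall R).norm
      (integrableOn_const measure_closedBall_lt_top.ne) Metric.isClosed_closedBall.measurableSet ?_
    intro v hv
    simpa using hv
  refine h1.trans (le_of_eq ?_)
  rw [setIntegral_const, Measure.addHaar_real_closedBall' volume 0 hR, smul_eq_mul]
  ring

theorem restrict_closedBall_neg_le {ξ : E} (hξ : ‖ξ‖ = 1) (ρ : ℝ) :
    (volume : Measure E).restrict (Metric.closedBall (-ξ) ρ) ≤
      volume.restrict (Metric.closedBall 0 (1 + ρ)) := by
  refine Measure.restrict_mono (Metric.closedBall_subset_closedBall' ?_) le_rfl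
  rw [dist_zero_right, norm_neg, hξ, add_comm]

omit [FiniteDimensional ℝ E] [MeasurableSpace E] [BorelSpace E] in
theorem inner_le_of_mem_closedBall_neg {ξ v a : E} {ρ r : ℝ}
    (hv : v ∈ Metric.closedBall (-ξ) ρ) (ha : r * ‖a‖ ≤ ⟪ξ, a⟫) :
    ⟪v, a⟫ ≤ -((r - ρ) * ‖a‖) := by
  rw [mem_closedBall_iff_norm, sub_neg_eq_add] at hv
  have h1 : ⟪v, a⟫ = ⟪v + ξ, a⟫ - ⟪ξ, a⟫ := by rw [inner_add_left]; ring
  have h2 := (real_inner_le_norm (v + ξ) a).trans (mul_le_mul_of_nonneg_right hv (norm_nonneg a))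
  linarith

/-- The reflection `v ↦ 2 • c - v` preserves both the ball and the volume. -/
theorem setIntegral_inner_closedBall (c e : E) (ρ : ℝ) :
    ∫ v in Metric.closedBall c ρ, ⟪v, e⟫ = volume.real (Metric.closedBall c ρ) * ⟪c, e⟫ := by
  have hint : IntegrableOn (fun v : E => ⟪v, e⟫) (Metric.closedBall c ρ) :=
    (by fun_prop : Continuous fun v : E => ⟪v, e⟫).continuousOn.integrableOn_compact
      (isCompact_closedBall c ρ)
  have h1 := (Measure.measurePreserving_sub_left (volume : Measure E) ((2 : ℝ) • c)).setIntegral_preimage_emb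
    (MeasurableEquiv.subLeft ((2 : ℝ) • c)).measurableEmbedding (fun v => ⟪v, e⟫)
    (Metric.closedBall c ρ)
  have h2 : (fun v => (2 : ℝ) • c - v) ⁻¹' Metric.closedBall c ρ = Metric.closedBall c ρ := by
    ext v
    rw [mem_preimage, mem_closedBall_iff_norm, mem_closedBall_iff_norm', two_smul]
    congr! 2
    abel
  rw [h2] at h1
  simp only [inner_sub_left, real_inner_smul_left] at h1
  have hconst : IntegrableOn (fun _ : E => 2 * ⟪c, e⟫) (Metric.closedBall c ρ) :=
    integrableOn_const measure_closedBall_lt_top.ne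
  rw [integral_sub hconst hint, setIntegral_const, smul_eq_mul] at h1
  linarith

end Ball

/-! ### Uniform measure on the circle, for the plane. -/

section Circle

/-- The unit vector of the plane at angle `θ`. -/
noncomputable def unitVec (θ : ℝ) : EuclideanSpace ℝ (Fin 2) := !₂[Real.cos θ, Real.sin θ]

theorem inner_unitVec (θ : ℝ) (a : EuclideanSpace ℝ (Fin 2)) :
    ⟪unitVec θ, a⟫ = Real.cos θ * a 0 + Real.sin θ * a 1 := by
  simp [unitVec, PiLp.inner_apply, Fin.sum_univ_two, mul_comm]

theorem norm_unitVec (θ : ℝ) : ‖unitVec θ‖ = 1 := by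
  simp [unitVec, EuclideanSpace.norm_eq, Fin.sum_univ_two]

theorem continuous_unitVec : Continuous unitVec := by
  unfold unitVec
  fun_prop

theorem exists_eq_unitVec {u : EuclideanSpace ℝ (Fin 2)} (hu : ‖u‖ = 1) : ∃ φ, u = unitVec φ := by
  have h : u 0 ^ 2 + u 1 ^ 2 = 1 := by
    have := EuclideanSpace.real_norm_sq_eq u
    rw [hu, Fin.sum_univ_two] at this
    linarith
  have hz : (⟨u 0, u 1⟩ : ℂ) ≠ 0 := by
    intro h0
    have h1 := congrArg Complex.re h0
    have h2 := congrArg Complex.im h0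
    simp at h1 h2
    simp [h1, h2] at h
  have hn : ‖(⟨u 0, u 1⟩ : ℂ)‖ = 1 := by
    rw [Complex.norm_def, Complex.normSq_mk, ← sq, ← sq, h, Real.sqrt_one]
  refine ⟨Complex.arg ⟨u 0, u 1⟩, ?_⟩
  ext i
  fin_cases i
  · simp [unitVec, Complex.cos_arg hz, hn]
  · simp [unitVec, Complex.sin_arg, hn]

/-- The uniform measure of total mass `2 * π` on the unit circle. -/
noncomputable def circleMeasure : Measure (EuclideanSpace ℝ (Fin 2)) :=
  (volume.restrict (Ioc 0 (0 + 2 * Real.pi))).map unitVec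

instance : IsFiniteMeasure circleMeasure := by
  unfold circleMeasure
  infer_instance

/-- The freedom in the starting angle lets any arc be treated as an interval without wrapping
around. -/
theorem circleMeasure_eq (t : ℝ) :
    circleMeasure = (volume.restrict (Ioc t (t + 2 * Real.pi))).map unitVec := by
  ext A hA
  have hm := continuous_unitVec.measurable
  rw [circleMeasure, Measure.map_apply hm hA, Measure.map_apply hm hA,
    Measure.restrict_apply (hm hA), Measure.restrict_apply (hm hA)]
  refine (isAddFundamentalDomain_Ioc Real.two_pi_pos 0).measure_set_eq
    (isAddFundamentalDomain_Ioc Real.two_pi_pos t) (hm hA) ?_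
  rintro ⟨g, hg⟩
  obtain ⟨n, rfl⟩ := AddSubgroup.mem_zmultiples_iff.1 hg
  ext θ
  have : unitVec (n • (2 * Real.pi) + θ) = unitVec θ := by
    rw [add_comm, zsmul_eq_mul]
    simp [unitVec]
  simp only [mem_preimage, AddSubgroup.vadd_def, vadd_eq_add, this]

theorem ae_norm_eq_one_circleMeasure : ∀ᵐ v ∂circleMeasure, ‖v‖ = 1 := by
  rw [circleMeasure, ae_map_iff continuous_unitVec.aemeasurable
    (measurableSet_eq_fun (by fun_prop) (by fun_prop))]
  exact ae_of_all _ norm_unitVec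

theorem integrable_id_circleMeasure : Integrable id circleMeasure :=
  Integrable.of_bound (by fun_prop) 1 (ae_norm_eq_one_circleMeasure.mono fun _ h => h.le)

theorem integral_norm_circleMeasure : ∫ v, ‖v‖ ∂circleMeasure = 2 * Real.pi := by
  rw [integral_congr_ae ae_norm_eq_one_circleMeasure, integral_const, circleMeasure,
    map_measureReal_apply continuous_unitVec.measurable MeasurableSet.univ]
  simp [Real.pi_pos.le]

/-- The uniform measure on the arc of half-width `δ` around the angle `φ`. -/
noncomputable def arcMeasure (φ δ : ℝ) : Measure (EuclideanSpace ℝ (Fin 2)) :=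
  (volume.restrict (Ioc (φ - δ) (φ + δ))).map unitVec

theorem arcMeasure_le (φ : ℝ) {δ : ℝ} (hδ : δ ≤ Real.pi) : arcMeasure φ δ ≤ circleMeasure := by
  rw [circleMeasure_eq (φ - Real.pi)]
  refine Measure.map_mono (Measure.restrict_mono (Ioc_subset_Ioc ?_ ?_) le_rfl)
    continuous_unitVec.measurable
  · linarith
  · linarith

theorem arcMeasure_real_univ (φ : ℝ) {δ : ℝ} (hδ : 0 ≤ δ) : (arcMeasure φ δ).real univ = 2 * δ := by
  rw [arcMeasure, map_measureReal_apply continuous_unitVec.measurable MeasurableSet.univ]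
  simp only [preimage_univ, measureReal_restrict_apply_univ, Real.volume_real_Ioc]
  rw [max_eq_left] <;> linarith

theorem integral_inner_arcMeasure (φ : ℝ) {δ : ℝ} (hδ : 0 ≤ δ) (e : EuclideanSpace ℝ (Fin 2)) :
    ∫ v, ⟪v, e⟫ ∂(arcMeasure φ δ) = 2 * Real.sin δ * ⟪unitVec φ, e⟫ := by
  rw [arcMeasure, integral_map continuous_unitVec.aemeasurable (by fun_prop),
    ← intervalIntegral.integral_of_le (by linarith)]
  simp only [inner_unitVec]
  rw [intervalIntegral.integral_add (Continuous.intervalIntegrable (by fun_prop) _ _)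
    (Continuous.intervalIntegrable (by fun_prop) _ _), intervalIntegral.integral_mul_const,
    intervalIntegral.integral_mul_const, integral_cos, integral_sin]
  rw [Real.sin_add, Real.sin_sub, Real.cos_add, Real.cos_sub]
  ring

/-- In the orthonormal frame at `φ`, the cone condition says that the axial coordinate `p` is at
least `‖a‖ / √2`, hence the transverse one `q` is at most that in absolute value. Rotation by `ε`
then costs at most the angle `|ε|` out of `π / 4`. -/
theorem inner_unitVec_le {φ θ δ : ℝ} (hδ : δ ≤ Real.pi / 4) (hθ : |θ - φ| ≤ δ)
    {a : EuclideanSpace ℝ (Fin 2)} (ha : ‖a‖ ≤ √2 * ⟪-unitVec φ, a⟫) :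
    ⟪unitVec θ, a⟫ ≤ -(Real.sin (Real.pi / 4 - δ) * ‖a‖) := by
  have hpi := Real.pi_pos
  obtain ⟨ε, rfl⟩ : ∃ ε, θ = φ + ε := ⟨θ - φ, by ring⟩
  rw [add_sub_cancel_left, abs_le] at hθ
  have h1 : Real.sin (Real.pi / 4 - δ) ≤ Real.sin (Real.pi / 4 - ε) :=
    Real.sin_le_sin_of_le_of_le_pi_div_two (by linarith) (by linarith) (by linarith)
  have h2 : Real.sin (Real.pi / 4 - δ) ≤ Real.sin (Real.pi / 4 + ε) :=
    Real.sin_le_sin_of_le_of_le_pi_div_two (by linarith) (by linarith) (by linarith)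
  have hC : 0 ≤ Real.cos ε := Real.cos_nonneg_of_mem_Icc ⟨by linarith, by linarith⟩
  rw [Real.sin_sub _ ε, Real.sin_pi_div_four, Real.cos_pi_div_four] at h1
  rw [Real.sin_add, Real.sin_pi_div_four, Real.cos_pi_div_four] at h2
  have hN : ‖a‖ ^ 2 = a 0 ^ 2 + a 1 ^ 2 := by
    rw [EuclideanSpace.real_norm_sq_eq, Fin.sum_univ_two]
  have hid := Real.sin_sq_add_cos_sq φ
  have hs : √2 * √2 = 2 := Real.mul_self_sqrt (by norm_num)
  have hs0 : 0 < √2 := by positivity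
  rw [inner_neg_left, inner_unitVec] at ha
  rw [inner_unitVec, Real.cos_add, Real.sin_add]
  set p := -(Real.cos φ * a 0 + Real.sin φ * a 1) with hp
  set q := -(Real.sin φ * a 0) + Real.cos φ * a 1 with hq
  have hpq : p ^ 2 + q ^ 2 = ‖a‖ ^ 2 := by
    rw [hN, hp, hq]
    linear_combination (a 0 ^ 2 + a 1 ^ 2) * hid
  have hn := norm_nonneg a
  have hpN : √2 / 2 * ‖a‖ ≤ p := by nlinarith
  have hqN : |q| ≤ √2 / 2 * ‖a‖ := by
    refine abs_le_of_sq_le_sq ?_ (by positivity)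
    have h3 := pow_le_pow_left₀ (by positivity) hpN 2
    nlinarith
  have hgoal : (Real.cos φ * Real.cos ε - Real.sin φ * Real.sin ε) * a 0 +
      (Real.sin φ * Real.cos ε + Real.cos φ * Real.sin ε) * a 1 =
      -(Real.cos ε * p) + Real.sin ε * q := by rw [hp, hq]; ring
  rw [hgoal]
  have h5 := mul_le_mul_of_nonneg_left hpN hC
  obtain ⟨hq1, hq2⟩ := abs_le.1 hqN
  rcases le_total 0 (Real.sin ε) with hS | hS
  · have h6 := mul_le_mul_of_nonneg_left hq2 hS
    have h7 := mul_le_mul_of_nonneg_right h1 hn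
    linarith
  · have h6 := mul_le_mul_of_nonpos_left hq1 hS
    have h7 := mul_le_mul_of_nonneg_right h2 hn
    linarith

theorem ae_arcMeasure_inner_le {φ δ : ℝ} (hδ : δ ≤ Real.pi / 4) :
    ∀ᵐ v ∂(arcMeasure φ δ), ∀ a : EuclideanSpace ℝ (Fin 2), ‖a‖ ≤ √2 * ⟪-unitVec φ, a⟫ →
      ⟪v, a⟫ ≤ -(Real.sin (Real.pi / 4 - δ) * ‖a‖) := by
  have hm : MeasurableSet {v | ∀ a : EuclideanSpace ℝ (Fin 2), ‖a‖ ≤ √2 * ⟪-unitVec φ, a⟫ →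
      ⟪v, a⟫ ≤ -(Real.sin (Real.pi / 4 - δ) * ‖a‖)} := by
    refine IsClosed.measurableSet ?_
    simp only [ofPred_forall]
    exact isClosed_iInter fun a => isClosed_iInter fun _ => isClosed_le (by fun_prop) (by fun_prop)
  rw [arcMeasure, ae_map_iff continuous_unitVec.aemeasurable hm]
  filter_upwards [ae_restrict_mem measurableSet_Ioc] with θ hθ a ha
  exact inner_unitVec_le hδ (abs_le.2 ⟨by linarith [hθ.1], by linarith [hθ.2]⟩) ha

end Circle

/-! ### Numerical comparison of the constants. -/

section Constants

/-- After logarithms this is `d + 1 ≤ 2 * d * log 2`, which fails for `d = 2`. -/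
theorem natCast_pow_succ_le_two_rpow {d : ℕ} (hd : 3 ≤ d) :
    (d : ℝ) ^ (d + 1) ≤ (2 : ℝ) ^ (2 * (d : ℝ) * Real.log d) := by
  have hd' : (3 : ℝ) ≤ d := by exact_mod_cast hd
  have h0 : (0 : ℝ) < d := by linarith
  rw [← Real.rpow_natCast, Real.rpow_def_of_pos h0, Real.rpow_def_of_pos two_pos, Real.exp_le_exp,
    Nat.cast_add, Nat.cast_one]
  have h1 := Real.log_two_gt_d9
  have h2 : 0 ≤ Real.log d := Real.log_nonneg (by linarith)
  have h3 : (d : ℝ) + 1 ≤ Real.log 2 * (2 * d) := by nlinarith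
  calc Real.log d * (d + 1) ≤ Real.log d * (Real.log 2 * (2 * d)) := by gcongr
    _ = _ := by ring

theorem sqrt_add_one_pow_le {d : ℕ} (hd : 3 ≤ d) :
    (√d + 1) ^ (d + 1) ≤ (2 : ℝ) ^ (2 * (d : ℝ) * Real.log d) := by
  have hd' : (3 : ℝ) ≤ d := by exact_mod_cast hd
  refine (pow_le_pow_left₀ (by positivity) ?_ _).trans (natCast_pow_succ_le_two_rpow hd)
  have h1 : √(d : ℝ) ≤ d - 1 := by
    rw [Real.sqrt_le_left (by linarith)]
    nlinarith
  linarith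

theorem two_mul_pow_le_two_rpow {d : ℕ} (hd : 3 ≤ d) :
    2 * (2 * √d + 1) ^ (d + 1) ≤ (2 : ℝ) ^ (4 * (d : ℝ) * Real.log d) := by
  have hd' : (3 : ℝ) ≤ d := by exact_mod_cast hd
  have h1 : √(d : ℝ) ≤ ((d : ℝ) ^ 2 - 2) / 4 := by
    rw [Real.sqrt_le_left (by nlinarith)]
    nlinarith [sq_nonneg ((d : ℝ) ^ 2 - 9), sq_nonneg ((d : ℝ) - 3)]
  calc 2 * (2 * √d + 1) ^ (d + 1) ≤ 2 ^ (d + 1) * (2 * √d + 1) ^ (d + 1) := by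
        gcongr
        exact le_self_pow₀ one_le_two (by omega)
    _ = (2 * (2 * √d + 1)) ^ (d + 1) := by rw [mul_pow]
    _ ≤ ((d : ℝ) ^ 2) ^ (d + 1) := by
        gcongr
        linarith
    _ = ((d : ℝ) ^ (d + 1)) ^ 2 := by rw [← pow_mul, ← pow_mul, mul_comm]
    _ ≤ ((2 : ℝ) ^ (2 * (d : ℝ) * Real.log d)) ^ 2 := by
        gcongr
        exact natCast_pow_succ_le_two_rpow hd
    _ = _ := by
        rw [← Real.rpow_natCast, ← Real.rpow_mul zero_le_two]
        congr 1
        push_cast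
        ring

theorem two_mul_pow_le_two_pow {d : ℕ} (hd : 1 ≤ d) :
    2 * (2 * √d + 1) ^ (d + 1) ≤ (2 : ℝ) ^ (10 * d ^ 2) := by
  have hd' : (1 : ℝ) ≤ d := by exact_mod_cast hd
  have h1 : √(d : ℝ) ≤ d := by
    rw [Real.sqrt_le_left (by linarith)]
    nlinarith
  have h2 : (d : ℝ) + 1 ≤ 2 ^ d := by exact_mod_cast Nat.lt_two_pow_self (n := d)
  calc 2 * (2 * √d + 1) ^ (d + 1) ≤ 2 * (2 ^ (d + 1)) ^ (d + 1) := by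
        gcongr
        rw [pow_succ]
        linarith
    _ = (2 : ℝ) ^ (1 + (d + 1) * (d + 1)) := by rw [← pow_mul, pow_add, pow_one]
    _ ≤ _ := by
        gcongr
        · exact one_le_two
        · nlinarith

theorem two_mul_pi_le_two_rpow : 2 * Real.pi ≤ (2 : ℝ) ^ (2 * 2 * Real.log 2) := by
  have h1 : (2 : ℝ) ^ (11 / 4 : ℝ) ≤ (2 : ℝ) ^ (2 * 2 * Real.log 2) :=
    Real.rpow_le_rpow_of_exponent_le one_le_two (by linarith [Real.log_two_gt_d9])
  have h2 : (6.3 : ℝ) ≤ (2 : ℝ) ^ (11 / 4 : ℝ) := by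
    refine (pow_le_pow_iff_left₀ (n := 4) (by norm_num) (by positivity) (by norm_num)).1 ?_
    rw [← Real.rpow_natCast ((2 : ℝ) ^ _), ← Real.rpow_mul zero_le_two]
    norm_num
  exact (by linarith [Real.pi_lt_d2] : 2 * Real.pi ≤ 6.3).trans (h2.trans h1)

theorem sixteen_le_sin_mul_two_rpow :
    16 ≤ Real.sin (Real.pi / 8) * (2 : ℝ) ^ (4 * 2 * Real.log 2) := by
  have h1 : (2 : ℝ) ^ (11 / 2 : ℝ) ≤ (2 : ℝ) ^ (4 * 2 * Real.log 2) :=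
    Real.rpow_le_rpow_of_exponent_le one_le_two (by linarith [Real.log_two_gt_d9])
  have h2 : (45 : ℝ) ≤ (2 : ℝ) ^ (11 / 2 : ℝ) := by
    refine (pow_le_pow_iff_left₀ (n := 2) (by norm_num) (by positivity) (by norm_num)).1 ?_
    rw [← Real.rpow_natCast ((2 : ℝ) ^ _), ← Real.rpow_mul zero_le_two]
    norm_num
  have h3 : (0.36 : ℝ) ≤ Real.sin (Real.pi / 8) := by
    rw [Real.sin_pi_div_eight]
    have h4 : √2 ≤ 1.4143 := by
      rw [Real.sqrt_le_left (by norm_num)]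
      norm_num
    have h5 : (0.72 : ℝ) ≤ √(2 - √2) := Real.le_sqrt_of_sq_le (by norm_num; linarith)
    linarith
  calc (16 : ℝ) ≤ 0.36 * 45 := by norm_num
    _ ≤ _ := mul_le_mul h3 (h2.trans h1) (by norm_num) ((by norm_num : (0 : ℝ) ≤ 0.36).trans h3)

end Constants

/-! ### Explicit length bounds in each dimension. -/

section Euclidean

variable {d : ℕ}

theorem nontrivial_euclideanSpace_fin (hd : 1 ≤ d) : Nontrivial (EuclideanSpace ℝ (Fin d)) :=
  Module.nontrivial_of_finrank_pos (R := ℝ) (by rw [finrank_euclideanSpace_fin]; omega)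

theorem SelfContractedOn.sum_norm_sub_le_sqrt_pow {x : ℕ → EuclideanSpace ℝ (Fin d)}
    (hd : 1 ≤ d) (hx : SelfContractedOn x univ) {z : EuclideanSpace ℝ (Fin d)}
    (hz : Tendsto x atTop (𝓝 z)) (N : ℕ) :
    ∑ k ∈ Finset.range N, ‖x k - x (k + 1)‖ ≤ 2 * (2 * √d + 1) ^ (d + 1) * ‖x 0 - z‖ := by
  have := nontrivial_euclideanSpace_fin hd
  have hs : 0 < √(d : ℝ) := Real.sqrt_pos.2 (by exact_mod_cast hd)
  -- The cone gives `1 / √d = 2 * ρ`: half is spent on the radius of the ball about `-ξ`, half is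
  -- kept as the margin `κ`.
  set ρ : ℝ := (2 * √d)⁻¹ with hρ
  have hρ0 : 0 < ρ := by positivity
  set w : ℝ := volume.real (Metric.closedBall (0 : EuclideanSpace ℝ (Fin d)) 1)
  have hw : 0 < w := ENNReal.toReal_pos (Metric.measure_closedBall_pos volume 0 one_pos).ne'
    measure_closedBall_lt_top.ne
  have : IsFiniteMeasure ((volume : Measure (EuclideanSpace ℝ (Fin d))).restrict
      (Metric.closedBall 0 (1 + ρ))) :=
    isFiniteMeasure_restrict.2 measure_closedBall_lt_top.ne
  have h := hx.sum_norm_sub_le hz (integrable_id_restrict_closedBall (1 + ρ)) (κ := ρ)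
    (m := ρ ^ d * w) hρ0.le (fun ξ hξ => ⟨_, restrict_closedBall_neg_le hξ ρ, ?_, ?_⟩) N
  · have hM := integral_norm_restrict_closedBall_le (E := EuclideanSpace ℝ (Fin d))
      (R := 1 + ρ) (by positivity)
    rw [finrank_euclideanSpace_fin] at hM
    have h1 : 2 * √d + 1 = (1 + ρ) / ρ := by
      rw [hρ]
      field_simp
    rw [h1, div_pow, ← mul_le_mul_iff_right₀ (by positivity : 0 < ρ ^ d * w * ρ)]
    refine h.trans ?_
    calc _ ≤ 2 * ((1 + ρ) ^ (d + 1) * w) * ‖x 0 - z‖ := by gcongr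
      _ = _ := by
        rw [pow_succ ρ]
        field_simp
  · rw [measureReal_restrict_apply_univ, Measure.addHaar_real_closedBall' volume _ hρ0.le,
      finrank_euclideanSpace_fin]
  · filter_upwards [ae_restrict_mem Metric.isClosed_closedBall.measurableSet] with v hv a ha
    rw [finrank_euclideanSpace_fin] at ha
    have h1 := inner_le_of_mem_closedBall_neg (r := 2 * ρ) hv (a := a) (by
      rw [hρ]
      field_simp
      linarith)
    linarith

theorem SelfContractedOn.sum_norm_sub_le_two_rpow {x : ℕ → EuclideanSpace ℝ (Fin d)}
    (hd : 2 ≤ d) (hx : SelfContractedOn x univ) {z : EuclideanSpace ℝ (Fin d)}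
    (hz : Tendsto x atTop (𝓝 z)) (N : ℕ) :
    ∑ k ∈ Finset.range N, ‖x k - x (k + 1)‖ ≤
      (2 : ℝ) ^ (4 * (d : ℝ) * Real.log d) * ‖x 0 - z‖ := by
  rcases hd.eq_or_lt with rfl | hd'
  · have := nontrivial_euclideanSpace_fin one_le_two
    have hpi := Real.pi_pos
    have hκ : 0 < Real.sin (Real.pi / 8) := Real.sin_pos_of_pos_of_lt_pi (by linarith) (by linarith)
    -- The angle `π / 4` is likewise split into two halves, giving the constant `16 / sin (π / 8)`.
    have h := hx.sum_norm_sub_le hz integrable_id_circleMeasure (κ := Real.sin (Real.pi / 8))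
      (m := Real.pi / 4) hκ.le (fun ξ hξ => ?_) N
    · rw [integral_norm_circleMeasure] at h
      push_cast
      rw [← mul_le_mul_iff_right₀ hκ]
      have h1 := mul_le_mul_of_nonneg_right sixteen_le_sin_mul_two_rpow (norm_nonneg (x 0 - z))
      rw [mul_assoc] at h1
      refine le_trans ?_ h1
      rw [← mul_le_mul_iff_right₀ (by positivity : 0 < Real.pi / 4)]
      linarith
    · obtain ⟨φ, hφ⟩ := exists_eq_unitVec (u := -ξ) (by rwa [norm_neg])
      refine ⟨arcMeasure φ (Real.pi / 8), arcMeasure_le φ (by linarith), ?_, ?_⟩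
      · rw [arcMeasure_real_univ φ (by positivity)]
        linarith
      · have h1 := ae_arcMeasure_inner_le (φ := φ) (δ := Real.pi / 8) (by linarith)
        rw [← hφ, neg_neg, show Real.pi / 4 - Real.pi / 8 = Real.pi / 8 by ring] at h1
        simpa using h1
  · refine (hx.sum_norm_sub_le_sqrt_pow (by omega) hz N).trans ?_
    gcongr
    exact two_mul_pow_le_two_rpow hd'

theorem SelfContractedOn.integral_norm_deriv_le_two_rpow {x g : ℝ → EuclideanSpace ℝ (Fin d)}
    (hd : 2 ≤ d) (hx : SelfContractedOn x (Ici 0))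
    (hder : ∀ t, 0 ≤ t → HasDerivWithinAt x (g t) (Ici 0) t) (hg : Continuous g)
    (hacute : ∀ s, 0 ≤ s → ∀ t, s ≤ t → 0 ≤ ⟪g s, x t - x s⟫) {z : EuclideanSpace ℝ (Fin d)}
    (hz : Tendsto x atTop (𝓝 z)) {T : ℝ} (hT : 0 ≤ T) :
    ∫ t in (0 : ℝ)..T, ‖g t‖ ≤ (2 : ℝ) ^ (2 * (d : ℝ) * Real.log d) * ‖x 0 - z‖ := by
  have := nontrivial_euclideanSpace_fin (one_le_two.trans hd)
  rcases hd.eq_or_lt with rfl | hd'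
  · have hpi := Real.pi_pos
    have h := hx.integral_norm_deriv_le hder hg hacute hz integrable_id_circleMeasure
      (m := √2) (by positivity) (fun ξ hξ => ?_) hT
    · rw [integral_norm_circleMeasure, finrank_euclideanSpace_fin, mul_assoc] at h
      push_cast at h ⊢
      refine (le_of_mul_le_mul_left h (by positivity)).trans ?_
      gcongr
      exact two_mul_pi_le_two_rpow
    · obtain ⟨φ, hφ⟩ := exists_eq_unitVec (u := -ξ) (by rwa [norm_neg])
      refine ⟨arcMeasure φ (Real.pi / 4), arcMeasure_le φ (by linarith), ?_, fun e => ?_⟩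
      · have h1 := ae_arcMeasure_inner_le (φ := φ) le_rfl
        rw [← hφ, neg_neg] at h1
        simpa using h1
      · rw [integral_inner_arcMeasure φ (by positivity), ← hφ, Real.sin_pi_div_four,
          inner_neg_left]
        ring
  -- For flows no margin is needed, so the ball may have the full radius `1 / √d`.
  · set ρ : ℝ := (√d)⁻¹ with hρ
    have hs : 0 < √(d : ℝ) := Real.sqrt_pos.2 (by exact_mod_cast (by omega : 0 < d))
    have hρ0 : 0 < ρ := by positivity
    set w : ℝ := volume.real (Metric.closedBall (0 : EuclideanSpace ℝ (Fin d)) 1)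
    have hw : 0 < w := ENNReal.toReal_pos (Metric.measure_closedBall_pos volume 0 one_pos).ne'
      measure_closedBall_lt_top.ne
    have h := hx.integral_norm_deriv_le hder hg hacute hz
      (integrable_id_restrict_closedBall (1 + ρ)) (m := ρ ^ d * w) (by positivity)
      (fun ξ hξ => ⟨_, restrict_closedBall_neg_le hξ ρ, ?_, fun e => ?_⟩) hT
    · have hM := integral_norm_restrict_closedBall_le (E := EuclideanSpace ℝ (Fin d))
        (R := 1 + ρ) (by positivity)
      rw [finrank_euclideanSpace_fin] at hM h
      have h1 : √d + 1 = (1 + ρ) / ρ := by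
        rw [hρ]
        field_simp
      refine le_trans ?_ (mul_le_mul_of_nonneg_right (sqrt_add_one_pow_le hd') (norm_nonneg _))
      rw [h1, div_pow, ← mul_le_mul_iff_right₀ (by positivity : 0 < ρ ^ d * w)]
      refine h.trans ?_
      calc _ ≤ √d * ((1 + ρ) ^ (d + 1) * w) * ‖x 0 - z‖ := by gcongr
        _ = _ := by
          rw [pow_succ ρ, show √(d : ℝ) = ρ⁻¹ by rw [hρ, inv_inv]]
          field_simp
    · filter_upwards [ae_restrict_mem Metric.isClosed_closedBall.measurableSet] with v hv a ha
      rw [finrank_euclideanSpace_fin] at ha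
      have h1 := inner_le_of_mem_closedBall_neg (r := ρ) hv (a := a) (by
        rw [hρ]
        field_simp
        linarith)
      simpa using h1
    · rw [setIntegral_inner_closedBall, Measure.addHaar_real_closedBall' volume _ hρ0.le,
        finrank_euclideanSpace_fin, inner_neg_left, mul_neg]

end Euclidean

/-! ### First-order inequalities for gradients. -/

section Gradient

variable {E : Type*} [NormedAddCommGroup E] [InnerProductSpace ℝ E] [CompleteSpace E]
  {f : E → ℝ}

theorem hasDerivAt_comp_add_smul (hf : Differentiable ℝ f) (x v : E) (t : ℝ) :
    HasDerivAt (fun t : ℝ => f (x + t • v)) ⟪gradient f (x + t • v), v⟫ t := by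
  have h1 : HasDerivAt (fun t : ℝ => x + t • v) v t := by
    simpa using ((hasDerivAt_id t).smul_const v).const_add x
  simpa [Function.comp_def] using
    (hf (x + t • v)).hasGradientAt.hasFDerivAt.comp_hasDerivAt t h1

theorem inner_gradient_le_of_segment (hf : Differentiable ℝ f) {x y : E} {c : ℝ}
    (h : ∀ t ∈ Ioo (0 : ℝ) 1, f (x + t • (y - x)) ≤ f x + t * c) :
    ⟪gradient f x, y - x⟫ ≤ c := by
  have h1 := hasDerivAt_comp_add_smul hf x (y - x) 0
  rw [zero_smul, add_zero] at h1
  refine le_of_tendsto (((hasDerivAt_iff_tendsto_slope.1 h1).mono_left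
    (nhdsWithin_mono 0 fun t (ht : (0 : ℝ) < t) => ht.ne') : Tendsto _ (𝓝[>] (0 : ℝ)) _)) ?_
  filter_upwards [Ioo_mem_nhdsGT one_pos] with t ht
  rw [slope_def_field, sub_zero, div_le_iff₀ ht.1, zero_smul, add_zero]
  linarith [h t ht]

omit [CompleteSpace E] in
theorem add_smul_sub_eq_combo (x y : E) (t : ℝ) : x + t • (y - x) = (1 - t) • x + t • y := by
  module

theorem QuasiconvexOn.inner_gradient_nonpos (hq : QuasiconvexOn ℝ univ f)
    (hf : Differentiable ℝ f) {x y : E} (hyx : f y ≤ f x) : ⟪gradient f x, y - x⟫ ≤ 0 := by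
  refine inner_gradient_le_of_segment hf fun t ht => ?_
  rw [mul_zero, add_zero, add_smul_sub_eq_combo]
  exact (hq (f x) ⟨mem_univ x, le_rfl⟩ ⟨mem_univ y, hyx⟩ (sub_nonneg.2 ht.2.le) ht.1.le
    (sub_add_cancel 1 t)).2

theorem ConvexOn.inner_gradient_le (hc : ConvexOn ℝ univ f) (hf : Differentiable ℝ f) (x y : E) :
    ⟪gradient f x, y - x⟫ ≤ f y - f x := by
  refine inner_gradient_le_of_segment hf fun t ht => ?_
  rw [add_smul_sub_eq_combo]
  refine (hc.2 (mem_univ x) (mem_univ y) (sub_nonneg.2 ht.2.le) ht.1.le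
    (sub_add_cancel 1 t)).trans (le_of_eq ?_)
  simp only [smul_eq_mul]
  ring

/-- The descent lemma. -/
theorem LipschitzWith.le_add_inner_gradient (hf : Differentiable ℝ f) {L : ℝ≥0}
    (hL : LipschitzWith L (gradient f)) (x v : E) :
    f (x + v) ≤ f x + ⟪gradient f x, v⟫ + L / 2 * ‖v‖ ^ 2 := by
  set ψ : ℝ → ℝ := fun t =>
    f (x + t • v) - (t * ⟪gradient f x, v⟫ + L / 2 * ‖v‖ ^ 2 * t ^ 2) with hψ
  have hd : ∀ t, HasDerivAt ψ (⟪gradient f (x + t • v), v⟫ -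
      (⟪gradient f x, v⟫ + L / 2 * ‖v‖ ^ 2 * (2 * t))) t := by
    intro t
    refine (hasDerivAt_comp_add_smul hf x v t).sub (HasDerivAt.add ?_ ?_)
    · simpa using (hasDerivAt_id t).mul_const ⟪gradient f x, v⟫
    · simpa using (hasDerivAt_pow 2 t).const_mul (L / 2 * ‖v‖ ^ 2)
  have hanti : AntitoneOn ψ (Ici 0) := by
    refine antitoneOn_of_deriv_nonpos (convex_Ici 0)
      (fun t _ => (hd t).continuousAt.continuousWithinAt)
      (fun t _ => (hd t).differentiableAt.differentiableWithinAt) fun t ht => ?_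
    rw [interior_Ici] at ht
    have ht' : 0 < t := ht
    rw [(hd t).deriv]
    have h1 : ⟪gradient f (x + t • v) - gradient f x, v⟫ ≤ L * (t * ‖v‖) * ‖v‖ := by
      refine (real_inner_le_norm _ _).trans (mul_le_mul_of_nonneg_right ?_ (norm_nonneg v))
      have := hL.dist_le_mul (x + t • v) x
      rwa [dist_eq_norm, dist_eq_norm, add_sub_cancel_left, norm_smul, Real.norm_eq_abs,
        abs_of_pos ht'] at this
    rw [inner_sub_left] at h1
    linarith
  have h := hanti (mem_Ici.2 le_rfl) (mem_Ici.2 zero_le_one) zero_le_one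
  simp only [hψ, one_smul, zero_smul, add_zero] at h
  linarith

end Gradient

/-! ### Fejér monotonicity: self-contractedness and convergence. -/

section Fejer

variable {E : Type*} [NormedAddCommGroup E] [InnerProductSpace ℝ E]
  {T : Type*} [LinearOrder T] {f : E → ℝ} {x : T → E} {i : T}

omit [InnerProductSpace ℝ E] in
theorem selfContractedOn_of_fejer (hanti : ∀ r s, i ≤ r → r ≤ s → f (x s) ≤ f (x r))
    (hfejer : ∀ y, ∀ r s, i ≤ r → r ≤ s → f y ≤ f (x s) → ‖x s - y‖ ≤ ‖x r - y‖) :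
    SelfContractedOn x (Ici i) := fun r hr s hrs t hst =>
  hfejer (x t) r s hr hrs (hanti s t (hr.trans hrs) hst)

/-- A descent method that approaches every better point converges. -/
theorem exists_tendsto_of_fejer [FiniteDimensional ℝ E] (hf : Continuous f)
    (hmin : ∃ y, IsMinOn f univ y) (hanti : ∀ r s, i ≤ r → r ≤ s → f (x s) ≤ f (x r))
    (hfejer : ∀ y, ∀ r s, i ≤ r → r ≤ s → f y ≤ f (x s) → ‖x s - y‖ ≤ ‖x r - y‖) :
    ∃ z, Tendsto x atTop (𝓝 z) := by
  have : Nonempty T := ⟨i⟩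
  obtain ⟨y, hy⟩ := hmin
  have hball : ∀ᶠ t in atTop, x t ∈ Metric.closedBall y ‖x i - y‖ := by
    filter_upwards [eventually_ge_atTop i] with t ht
    rw [mem_closedBall_iff_norm]
    exact hfejer y i t le_rfl ht (hy (mem_univ _))
  obtain ⟨z, -, hz⟩ := (isCompact_closedBall y ‖x i - y‖).exists_mapClusterPt_of_frequently
    hball.frequently
  -- The cluster point is thus better than every iterate, so the distance to it is nonincreasing and
  -- convergence follows.
  have hfz : ∀ s, i ≤ s → f z ≤ f (x s) := by
    intro s hs
    by_contra! hlt
    have h1 := hz.frequently (hf.continuousAt.eventually (eventually_gt_nhds hlt))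
    obtain ⟨t, ht, hst⟩ := (h1.and_eventually (eventually_ge_atTop s)).exists
    exact (hanti s t hs hst).not_gt ht
  refine ⟨z, Metric.tendsto_atTop.2 fun ε hε => ?_⟩
  obtain ⟨t, ht, hit⟩ := ((hz.frequently (Metric.ball_mem_nhds z hε)).and_eventually
    (eventually_ge_atTop i)).exists
  refine ⟨t, fun s hts => ?_⟩
  rw [dist_eq_norm] at ht ⊢
  exact (hfejer z t s hit hts (hfz s (hit.trans hts))).trans_lt ht

end Fejer

/-! ### Gradient flow is a Fejér monotone descent. -/

section GradientFlow

variable {d : ℕ} {f : EuclideanSpace ℝ (Fin d) → ℝ} {x : ℝ → EuclideanSpace ℝ (Fin d)}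

theorem IsGradientFlow.comp_antitoneOn (hx : IsGradientFlow f x) (hf : Differentiable ℝ f) :
    AntitoneOn (fun t => f (x t)) (Ici 0) := by
  have hd : ∀ t, 0 ≤ t → HasDerivWithinAt (fun t => f (x t)) (-‖gradient f (x t)‖ ^ 2) (Ici 0) t := by
    intro t ht
    have := (hf (x t)).hasGradientAt.hasFDerivAt.comp_hasDerivWithinAt t (hx t ht)
    refine this.congr_deriv ?_
    rw [InnerProductSpace.toDual_apply_apply, inner_neg_right, real_inner_self_eq_norm_sq]
  refine antitoneOn_of_hasDerivWithinAt_nonpos (f' := fun t => -‖gradient f (x t)‖ ^ 2)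
    (convex_Ici 0) (fun t ht => (hd t ht).continuousWithinAt)
    (fun t ht => (hd t (interior_subset ht)).mono interior_subset) fun t _ => ?_
  simp

theorem IsGradientFlow.norm_sub_le (hx : IsGradientFlow f x) {y : EuclideanSpace ℝ (Fin d)}
    {r s : ℝ} (hr : 0 ≤ r) (hrs : r ≤ s)
    (h : ∀ t ∈ Icc r s, ⟪gradient f (x t), y - x t⟫ ≤ 0) : ‖x s - y‖ ≤ ‖x r - y‖ := by
  have hd : ∀ t ∈ Icc r s, HasDerivWithinAt (fun t => ‖x t - y‖ ^ 2)
      (2 * ⟪x t - y, -gradient f (x t)⟫) (Icc r s) t := fun t ht =>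
    (((hx t (hr.trans ht.1)).mono fun u hu => hr.trans hu.1).sub_const y).norm_sq
  have hanti := antitoneOn_of_hasDerivWithinAt_nonpos
    (f' := fun t => 2 * ⟪x t - y, -gradient f (x t)⟫)
    (convex_Icc r s) (fun t ht => (hd t ht).continuousWithinAt)
    (fun t ht => (hd t (interior_subset ht)).mono interior_subset) (fun t ht => by
      have h1 := h t (interior_subset ht)
      rw [← neg_sub, inner_neg_neg, real_inner_comm]
      linarith)
  exact le_of_sq_le_sq (hanti (left_mem_Icc.2 hrs) (right_mem_Icc.2 hrs) hrs) (norm_nonneg _)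

theorem flowPathLength_le {g : ℝ → EuclideanSpace ℝ (Fin d)}
    (hder : ∀ t, 0 ≤ t → HasDerivWithinAt x (g t) (Ici 0) t) (hg : Continuous g) {C : ℝ}
    (h : ∀ T, 0 ≤ T → ∫ t in (0 : ℝ)..T, ‖g t‖ ≤ C) : flowPathLength x ≤ ENNReal.ofReal C := by
  have hU : Ici (0 : ℝ) = ⋃ n : ℕ, Icc 0 (n : ℝ) := by
    ext t
    simp only [mem_Ici, mem_iUnion, mem_Icc, exists_and_left, iff_self_and]
    exact fun _ => exists_nat_ge t
  have hmono : Monotone fun n : ℕ => Icc (0 : ℝ) n := fun m n hmn =>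
    Icc_subset_Icc_right (Nat.cast_le.2 hmn)
  rw [flowPathLength]
  conv_lhs => rw [setLIntegral_congr_fun (g := fun t => ‖g t‖ₑ) measurableSet_Ici
    fun t ht => by rw [(hder t ht).derivWithin (uniqueDiffOn_Ici 0 t ht)]]
  rw [hU, setLIntegral_iUnion_of_directed _ hmono.directed_le]
  refine iSup_le fun n => ?_
  rw [← ofReal_integral_norm_eq_lintegral_enorm hg.continuousOn.integrableOn_Icc,
    integral_Icc_eq_integral_Ioc, ← intervalIntegral.integral_of_le n.cast_nonneg]
  exact ENNReal.ofReal_le_ofReal (h n n.cast_nonneg)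

end GradientFlow

/-! ### Gradient descent is a Fejér monotone descent. -/

section GradientDescent

variable {d : ℕ} {f : EuclideanSpace ℝ (Fin d) → ℝ} {x : ℕ → EuclideanSpace ℝ (Fin d)}
  {η : ℝ} {L : ℝ≥0}

theorem IsGradientDescent.comp_succ_le (hx : IsGradientDescent f η x) (hf : Differentiable ℝ f)
    (hL : LipschitzWith L (gradient f)) (hη : 0 ≤ η) (hηL : η * L ≤ 1) (k : ℕ) :
    f (x (k + 1)) + η / 2 * ‖gradient f (x k)‖ ^ 2 ≤ f (x k) := by
  have h := hL.le_add_inner_gradient hf (x k) (-(η • gradient f (x k)))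
  rw [← sub_eq_add_neg, ← hx k, inner_neg_right, real_inner_smul_right,
    real_inner_self_eq_norm_sq, norm_neg, norm_smul, Real.norm_of_nonneg hη] at h
  have h1 := mul_le_mul_of_nonneg_right hηL
    (by positivity : 0 ≤ η / 2 * ‖gradient f (x k)‖ ^ 2)
  nlinarith

theorem IsGradientDescent.comp_antitone (hx : IsGradientDescent f η x) (hf : Differentiable ℝ f)
    (hL : LipschitzWith L (gradient f)) (hη : 0 ≤ η) (hηL : η * L ≤ 1) :
    Antitone fun k => f (x k) :=
  antitone_nat_of_succ_le fun k => (le_add_of_nonneg_right (by positivity)).trans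
    (hx.comp_succ_le hf hL hη hηL k)

/-- Since `y` is no worse than the new iterate, it beats the old one by at least `η / 2 * ‖∇f‖ ^ 2`.
With convexity, this pays for the quadratic term in the expanded square of the new distance. -/
theorem IsGradientDescent.norm_sub_le (hx : IsGradientDescent f η x) (hc : ConvexOn ℝ univ f)
    (hf : Differentiable ℝ f) (hL : LipschitzWith L (gradient f)) (hη : 0 ≤ η) (hηL : η * L ≤ 1)
    {y : EuclideanSpace ℝ (Fin d)} {r s : ℕ} (hrs : r ≤ s) (hy : f y ≤ f (x s)) :
    ‖x s - y‖ ≤ ‖x r - y‖ := by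
  induction s, hrs using Nat.le_induction with
  | base => exact le_rfl
  | succ k _ ih =>
    have h1 := hx.comp_succ_le hf hL hη hηL k
    refine le_trans ?_ (ih (hy.trans (hx.comp_antitone hf hL hη hηL k.le_succ)))
    refine le_of_sq_le_sq ?_ (norm_nonneg _)
    have h2 := hc.inner_gradient_le hf (x k) y
    rw [hx k, sub_right_comm, norm_sub_sq_real, real_inner_smul_right, norm_smul,
      Real.norm_of_nonneg hη, ← neg_sub y (x k), inner_neg_left, real_inner_comm, norm_neg]
    have h3 := mul_le_mul_of_nonneg_left (h2.trans
      (by linarith : f y - f (x k) ≤ -(η / 2 * ‖gradient f (x k)‖ ^ 2))) hη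
    nlinarith

theorem descentPathLength_le {C : ℝ}
    (h : ∀ N, ∑ k ∈ Finset.range N, ‖x k - x (k + 1)‖ ≤ C) :
    descentPathLength x ≤ ENNReal.ofReal C := by
  refine ENNReal.tsum_le_of_sum_range_le fun N => ?_
  simp only [← ofReal_norm]
  rw [← ENNReal.ofReal_sum_of_nonneg fun _ _ => norm_nonneg _]
  exact ENNReal.ofReal_le_ofReal (h N)

end GradientDescent

/-! ### Dimension one: monotone motion towards the limit. -/

section Line

theorem inner_eq_norm_mul_norm_of_nonneg {a b : EuclideanSpace ℝ (Fin 1)} (h : 0 ≤ ⟪a, b⟫) :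
    ⟪a, b⟫ = ‖a‖ * ‖b‖ := by
  simp only [PiLp.inner_apply, Fin.sum_univ_one, EuclideanSpace.norm_eq, Real.sqrt_sq_eq_abs,
    Real.norm_eq_abs, sq_abs] at h ⊢
  rw [← abs_mul, mul_comm]
  exact (abs_of_nonneg h).symm

theorem SelfContractedOn.integral_norm_deriv_le_of_line
    {x g : ℝ → EuclideanSpace ℝ (Fin 1)} (hx : SelfContractedOn x (Ici 0))
    (hder : ∀ t, 0 ≤ t → HasDerivWithinAt x (g t) (Ici 0) t) (hg : Continuous g)
    (hacute : ∀ s, 0 ≤ s → ∀ t, s ≤ t → 0 ≤ ⟪g s, x t - x s⟫) {z : EuclideanSpace ℝ (Fin 1)}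
    (hz : Tendsto x atTop (𝓝 z)) {T : ℝ} (hT : 0 ≤ T) :
    ∫ t in (0 : ℝ)..T, ‖g t‖ ≤ ‖x 0 - z‖ := by
  have hgz : ∀ s, 0 ≤ s → 0 ≤ ⟪g s, z - x s⟫ := fun s hs =>
    ge_of_tendsto (tendsto_const_nhds.inner (hz.sub_const (x s)))
      ((eventually_ge_atTop s).mono fun t ht => hacute s hs t ht)
  set B : ℝ → ℝ := fun τ => ‖x 0 - z‖ - ∫ u in (0 : ℝ)..τ, ‖g u‖ with hB
  have hBd : ∀ τ, HasDerivAt B (-‖g τ‖) τ := fun τ =>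
    ((hg.norm.integral_hasStrictDerivAt 0 τ).hasDerivAt).const_sub _
  have key := image_le_of_liminf_slope_right_le_deriv_boundary (f := fun t => ‖x t - z‖)
    (a := 0) (b := T)
    (fun t ht => (((hder t ht.1).continuousWithinAt.mono fun u hu => hu.1).sub_const z).norm)
    (B := B) (B' := fun τ => -‖g τ‖) (by simp [hB])
    (fun τ _ => (hBd τ).continuousAt.continuousWithinAt)
    (fun τ _ => (hBd τ).hasDerivWithinAt) ?_ (right_mem_Icc.2 hT)
  · have := norm_nonneg (x T - z)
    simp only [hB] at key
    linarith
  · intro τ hτ r hr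
    have hd : HasDerivWithinAt x (g τ) (Ici τ) τ := (hder τ hτ.1).mono (Ici_subset_Ici.2 hτ.1)
    refine Eventually.frequently ?_
    by_cases hxz : x τ = z
    · have hconst : ∀ t, τ ≤ t → x t = z := fun t ht => by
        have := hx.norm_sub_lim_le hz hτ.1 ht
        rwa [hxz, sub_self, norm_zero, norm_le_zero_iff, sub_eq_zero] at this
      have hg0 : g τ = 0 := (uniqueDiffWithinAt_Ici τ).eq_deriv _ hd
        ((hasDerivWithinAt_const τ (Ici τ) z).congr (fun t ht => hconst t ht) hxz)
      rw [hg0, norm_zero, neg_zero] at hr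
      filter_upwards [self_mem_nhdsWithin] with t ht
      simpa [slope_def_field, hconst t (le_of_lt ht), hxz] using hr
    · have hpos : 0 < ‖x τ - z‖ := norm_pos_iff.2 (sub_ne_zero.2 hxz)
      -- Off `z` the distance is differentiable, and since the velocity points at `z` its derivative
      -- is exactly `-‖g τ‖`.
      have h1 : HasDerivWithinAt (fun t => √(‖x t - z‖ ^ 2))
          ((2 * ⟪x τ - z, g τ⟫) / (2 * √(‖x τ - z‖ ^ 2))) (Ici τ) τ :=
        ((hd.sub_const z).norm_sq).sqrt (by positivity)
      simp only [Real.sqrt_sq (norm_nonneg _)] at h1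
      have h2 : (2 * ⟪x τ - z, g τ⟫) / (2 * ‖x τ - z‖) = -‖g τ‖ := by
        have h3 := inner_eq_norm_mul_norm_of_nonneg (hgz τ hτ.1)
        rw [← neg_sub (x τ) z, inner_neg_right, norm_neg, real_inner_comm] at h3
        rw [div_eq_iff (by positivity)]
        linarith
      rw [h2, hasDerivWithinAt_iff_tendsto_slope, Ici_sdiff_left] at h1
      exact h1.eventually_lt_const hr

theorem IsGradientDescent.sum_norm_sub_le_of_line {f : EuclideanSpace ℝ (Fin 1) → ℝ} {η : ℝ}
    {L : ℝ≥0} {x : ℕ → EuclideanSpace ℝ (Fin 1)} (hx : IsGradientDescent f η x)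
    (hc : ConvexOn ℝ univ f) (hf : Differentiable ℝ f) (hL : LipschitzWith L (gradient f))
    (hη : 0 < η) (hηL : η * L ≤ 1) {z : EuclideanSpace ℝ (Fin 1)} (hz : Tendsto x atTop (𝓝 z))
    (N : ℕ) : ∑ k ∈ Finset.range N, ‖x k - x (k + 1)‖ ≤ ‖x 0 - z‖ := by
  have hgz : gradient f z = 0 := by
    have h1 : Tendsto (fun k => x k - x (k + 1)) atTop (𝓝 (η • gradient f z)) := by
      have h2 : (fun k => x k - x (k + 1)) = fun k => η • gradient f (x k) := by
        ext1 k
        rw [hx k, sub_sub_cancel]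
      rw [h2]
      exact ((hL.continuous.tendsto z).comp hz).const_smul η
    have h3 := hz.sub (hz.comp (tendsto_add_atTop_nat 1))
    rw [sub_self] at h3
    exact (smul_eq_zero.1 (tendsto_nhds_unique h1 h3)).resolve_left hη.ne'
  have hstep : ∀ k, ‖x k - x (k + 1)‖ ≤ ‖x k - z‖ - ‖x (k + 1) - z‖ := by
    intro k
    have h1 : f z ≤ f (x k) := le_of_tendsto ((hf.continuous.tendsto z).comp hz)
      ((eventually_ge_atTop k).mono fun j hj => hx.comp_antitone hf hL hη.le hηL hj)
    have h2 : 0 ≤ ⟪η • gradient f (x k), x k - z⟫ := by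
      have := hc.inner_gradient_le hf (x k) z
      rw [← neg_sub, inner_neg_right] at this
      rw [real_inner_smul_left]
      exact mul_nonneg hη.le (by linarith)
    -- A step cannot overshoot `z`, because the gradient vanishes there and `η * L ≤ 1`.
    have h3 : ‖η • gradient f (x k)‖ ≤ ‖x k - z‖ := by
      have := hL.dist_le_mul (x k) z
      rw [dist_eq_norm, dist_eq_norm, hgz, sub_zero] at this
      rw [norm_smul, Real.norm_of_nonneg hη.le]
      calc η * ‖gradient f (x k)‖ ≤ η * (L * ‖x k - z‖) := by gcongr
        _ = η * L * ‖x k - z‖ := by ring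
        _ ≤ _ := mul_le_of_le_one_left (norm_nonneg _) hηL
    have h4 := inner_eq_norm_mul_norm_of_nonneg h2
    rw [hx k, sub_sub_cancel, sub_right_comm, le_sub_comm]
    refine le_of_sq_le_sq ?_ (sub_nonneg.2 h3)
    rw [norm_sub_sq_real, real_inner_comm, h4]
    linarith
  refine (Finset.sum_le_sum fun k _ => hstep k).trans ?_
  rw [Finset.sum_range_sub']
  linarith [norm_nonneg (x N - z)]

end Line

/-! ### Assembly of the main theorem. -/

theorem theorem6 {d : ℕ} (f : EuclideanSpace ℝ (Fin d) → ℝ)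
    (hf : ContDiff ℝ 1 f) (hmin : ∃ xs : EuclideanSpace ℝ (Fin d), IsMinOn f univ xs) :
    -- gradient flow of a quasiconvex function
    (QuasiconvexOn ℝ univ f →
      ∀ x : ℝ → EuclideanSpace ℝ (Fin d), IsGradientFlow f x →
        ∃ xinf : EuclideanSpace ℝ (Fin d), Tendsto x atTop (𝓝 xinf) ∧
          flowPathLength x ≤
            ENNReal.ofReal ((2 : ℝ) ^ (2 * (d : ℝ) * Real.log (d : ℝ)) * ‖x 0 - xinf‖)) ∧
    -- gradient descent on a convex function with Lipschitz gradient
    (ConvexOn ℝ univ f →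
      ∀ L : ℝ≥0, 0 < L → LipschitzWith L (gradient f) →
      ∀ η : ℝ, 0 < η →
      ∀ x : ℕ → EuclideanSpace ℝ (Fin d), IsGradientDescent f η x →
        (η ≤ 1 / (L : ℝ) →
          ∃ xinf : EuclideanSpace ℝ (Fin d), Tendsto x atTop (𝓝 xinf) ∧
            descentPathLength x ≤
              ENNReal.ofReal ((2 : ℝ) ^ (10 * d ^ 2) * ‖x 0 - xinf‖)) ∧
        (η ≤ 1 / (2 * (L : ℝ) * Real.sqrt (d : ℝ)) →
          ∃ xinf : EuclideanSpace ℝ (Fin d), Tendsto x atTop (𝓝 xinf) ∧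
            descentPathLength x ≤
              ENNReal.ofReal ((2 : ℝ) ^ (4 * (d : ℝ) * Real.log (d : ℝ)) * ‖x 0 - xinf‖))) := by
  have hdf : Differentiable ℝ f := hf.differentiable one_ne_zero
  refine ⟨fun hq x hx => ?_, fun hc L hL0 hL η hη x hx => ?_⟩
  · have hanti : ∀ r s : ℝ, 0 ≤ r → r ≤ s → f (x s) ≤ f (x r) := fun r s hr hrs =>
      hx.comp_antitoneOn hdf hr (hr.trans hrs) hrs
    have hfejer : ∀ y, ∀ r s : ℝ, 0 ≤ r → r ≤ s → f y ≤ f (x s) → ‖x s - y‖ ≤ ‖x r - y‖ :=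
      fun y r s hr hrs hy => hx.norm_sub_le hr hrs fun t ht =>
        hq.inner_gradient_nonpos hdf (hy.trans (hanti t s (hr.trans ht.1) ht.2))
    have hsc := selfContractedOn_of_fejer hanti hfejer
    obtain ⟨z, hz⟩ := exists_tendsto_of_fejer hf.continuous hmin hanti hfejer
    refine ⟨z, hz, ?_⟩
    -- Freezing the velocity at its initial value for negative times makes it continuous on the
    -- whole line.
    set g : ℝ → EuclideanSpace ℝ (Fin d) := fun t => -gradient f (x (max t 0)) with hgdef
    have hxc : ContinuousOn x (Ici 0) := fun t ht => (hx t ht).continuousWithinAt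
    have hgc : Continuous (gradient f) :=
      (InnerProductSpace.toDual ℝ _).symm.continuous.comp (hf.continuous_fderiv one_ne_zero)
    have hg : Continuous g := (hgc.comp
      (hxc.comp_continuous (by fun_prop) fun t => le_max_right t 0)).neg
    have hgt : ∀ t, 0 ≤ t → g t = -gradient f (x t) := fun t ht => by
      simp only [hgdef, max_eq_left ht]
    have hder : ∀ t, 0 ≤ t → HasDerivWithinAt x (g t) (Ici 0) t := fun t ht => by
      rw [hgt t ht]
      exact hx t ht
    have hacute : ∀ s, 0 ≤ s → ∀ t, s ≤ t → 0 ≤ inner ℝ (g s) (x t - x s) := fun s hs t hst => by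
      rw [hgt s hs, inner_neg_left, neg_nonneg]
      exact hq.inner_gradient_nonpos hdf (hanti s t hs hst)
    refine flowPathLength_le hder hg fun T hT => ?_
    rcases (by omega : d = 0 ∨ d = 1 ∨ 2 ≤ d) with rfl | rfl | hd
    · simp [norm_of_subsingleton]
    · simpa using hsc.integral_norm_deriv_le_of_line hder hg hacute hz hT
    · exact hsc.integral_norm_deriv_le_two_rpow hd hder hg hacute hz hT
  · have hL' : (0 : ℝ) < L := hL0
    have hmain : η * L ≤ 1 → SelfContractedOn x univ ∧ ∃ z, Tendsto x atTop (𝓝 z) := by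
      intro hηL
      have hanti : ∀ r s : ℕ, 0 ≤ r → r ≤ s → f (x s) ≤ f (x r) := fun r s _ hrs =>
        hx.comp_antitone hdf hL hη.le hηL hrs
      have hfejer : ∀ y, ∀ r s : ℕ, 0 ≤ r → r ≤ s → f y ≤ f (x s) → ‖x s - y‖ ≤ ‖x r - y‖ :=
        fun y r s _ hrs hy => hx.norm_sub_le hc hdf hL hη.le hηL hrs hy
      have hsc := selfContractedOn_of_fejer hanti hfejer
      exact ⟨fun r _ => hsc r r.zero_le, exists_tendsto_of_fejer hf.continuous hmin hanti hfejer⟩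
    refine ⟨fun h => ?_, fun h => ?_⟩
    · obtain ⟨hsc, z, hz⟩ := hmain ((le_div_iff₀ hL').1 h)
      refine ⟨z, hz, descentPathLength_le fun N => ?_⟩
      rcases d.eq_zero_or_pos with rfl | hd
      · simp [norm_of_subsingleton]
      · refine (hsc.sum_norm_sub_le_sqrt_pow hd hz N).trans ?_
        gcongr
        exact two_mul_pow_le_two_pow hd
    · rcases d.eq_zero_or_pos with rfl | hd
      -- For `d = 0` the bound on `η` is a division by zero, hence 0, contradicting `0 < η`.
      · exact absurd h (by simpa using hη)
      have hs : 1 ≤ √(d : ℝ) := Real.one_le_sqrt.2 (by exact_mod_cast hd)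
      have hηL : η * L ≤ 1 := by
        rw [le_div_iff₀ (by positivity)] at h
        nlinarith [mul_pos hη hL']
      obtain ⟨hsc, z, hz⟩ := hmain hηL
      refine ⟨z, hz, descentPathLength_le fun N => ?_⟩
      rcases (by omega : d = 1 ∨ 2 ≤ d) with rfl | hd
      · simpa using hx.sum_norm_sub_le_of_line hc hdf hL hη hηL hz N
      · exact hsc.sum_norm_sub_le_two_rpow hd hz N
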